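/- Let $G$ be a Lie group and let $\tau:P\to M$ be a smooth principal $G$-bundle with right action $(u,g)\mapsto u\cdot g$, where all manifolds are real, finite-dimensional, smooth, Hausdorff, second countable and without boundary. Let $$J^1P=\{\rho:T_{\tau(u)}M\to T_uP \text{ linear}\;:\;u\in P,\ T_u\tau\circ\rho=\mathrm{id}\},$$ regarded as an embedded submanifold of the vector bundle $\mathrm{Hom}(\tau^*TM,TP)$ over $P$. The $1$-jet at $x$ of a local section $s$ of $\tau$ is $j^1_xs:=T_xs\in J^1P$, and every element of $J^1P$ is of this form. Put $\tau_{10}(\rho):=u$ for $\rho:T_{\tau(u)}M\to T_uP$ in $J^1P$, so that $\tau_{10}(j^1_xs)=s(x)$. The group $G$ acts on $J^1P$ from the right by $\rho\cdot g:=T_uR_g\circ\rho$, where $R_g(u)=u\cdot g$; let $C(P):=J^1P/G$ be the orbit space with the quotient topology, $p_G:J^1P\to J^1P/G$, $\rho\mapsto[\rho]_G$, the projection, and $p:J^1P/G\to M$, $p([j^1_xs]_G):=x$. Then $J^1P/G$ is a smooth (Hausdorff, second countable) manifold, with the unique smooth structure for which $p_G$ is a submersion; $p_G$ is a principal $G$-bundle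 and $p$ is smooth. Moreover the pullback $$p^*P=\{(c,u)\in J^1P/G\times P\;:\;p(c)=\tau(u)\},$$ an embedded submanifold of $J^1P/G\times P$, with the action $(c,u)\cdot g=(c,u\cdot g)$ and the projection $p_1(c,u)=c$, is a principal $G$-bundle over $J^1P/G$, and the map $$J^1P\to p^*P,\qquad j^1_xs\mapsto\bigl([j^1_xs]_G,\,s(x)\bigr)$$ is an isomorphism of principal $G$-bundles over $J^1P/G$, that is, a $G$-equivariant diffeomorphism covering the identity of $J^1P/G$. -/

import Mathlib

open scoped Manifold ContDiff Bundle Topology RightActions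

noncomputable section

section General

variable {E_B H_B E_X H_X E_G H_G : Type*}
  [NormedAddCommGroup E_B] [NormedSpace ℝ E_B] [TopologicalSpace H_B]
  [NormedAddCommGroup E_X] [NormedSpace ℝ E_X] [TopologicalSpace H_X]
  [NormedAddCommGroup E_G] [NormedSpace ℝ E_G] [TopologicalSpace H_G]
  {B X G : Type*}
  [TopologicalSpace B] [ChartedSpace H_B B] [TopologicalSpace X] [ChartedSpace H_X X]
  [TopologicalSpace G] [ChartedSpace H_G G] [Group G] [MulAction Gᵐᵒᵖ X]

/-- `pr : X → B` is a smooth principal `G`-bundle: `G` acts smoothly on `X` from the right (a right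
action is an action of `Gᵐᵒᵖ`, written `x <• g`), `pr` is smooth and invariant, and over a
neighbourhood `U` of every point of `B` there is an equivariant diffeomorphism
`pr ⁻¹' U ≃ U × G` over `U`. -/
structure IsPrincipalBundle (I_X : ModelWithCorners ℝ E_X H_X) (I_B : ModelWithCorners ℝ E_B H_B)
    (I_G : ModelWithCorners ℝ E_G H_G) (pr : X → B) : Prop where
  contMDiff_act : ContMDiff (I_X.prod I_G) I_X ∞ (fun q : X × G => q.1 <• q.2)
  contMDiff_proj : ContMDiff I_X I_B ∞ pr
  proj_act : ∀ (x : X) (g : G), pr (x <• g) = pr x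
  exists_trivialization : ∀ b : B, ∃ (U : Set B)
    (φ : PartialDiffeomorph I_X (I_B.prod I_G) X (B × G) ∞),
    IsOpen U ∧ b ∈ U ∧ φ.source = pr ⁻¹' U ∧ φ.target = U ×ˢ Set.univ ∧
    (∀ x ∈ φ.source, (φ.toPartialEquiv x).1 = pr x) ∧
    (∀ x ∈ φ.source, ∀ g : G,
      (φ.toPartialEquiv (x <• g)).2 = (φ.toPartialEquiv x).2 * g)

variable {E_Y H_Y Y : Type*} [NormedAddCommGroup E_Y] [NormedSpace ℝ E_Y] [TopologicalSpace H_Y]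
  [TopologicalSpace Y] [ChartedSpace H_Y Y]

/-- `f : X → Y` is an isomorphism from the principal `G`-bundle `pr : X → B` to the principal
`G`-bundle `pr' : Y → B`: a `G`-equivariant diffeomorphism covering the identity of `B`. -/
structure IsPrincipalBundleIso (G : Type*) [Group G] [MulAction Gᵐᵒᵖ X] [MulAction Gᵐᵒᵖ Y]
    (I_X : ModelWithCorners ℝ E_X H_X) (I_Y : ModelWithCorners ℝ E_Y H_Y)
    (pr : X → B) (pr' : Y → B) (f : X → Y) : Prop where
  diffeomorph : ∃ Φ : Diffeomorph I_X I_Y X Y ∞, ⇑Φ = f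
  proj_comp : ∀ x, pr' (f x) = pr x
  map_act : ∀ (x : X) (g : G), f (x <• g) = f x <• g

end General

/-- A smooth principal `G`-bundle `P → M`; the manifolds `M`, `G`, `P` (without boundary) are
modelled on the vector spaces `E_M`, `E_G`, `E_P`. -/
structure PrincipalBundle (E_M E_G E_P M G P : Type*)
    [NormedAddCommGroup E_M] [NormedSpace ℝ E_M] [NormedAddCommGroup E_G] [NormedSpace ℝ E_G]
    [NormedAddCommGroup E_P] [NormedSpace ℝ E_P]
    [TopologicalSpace M] [ChartedSpace E_M M] [TopologicalSpace G] [ChartedSpace E_G G]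
    [TopologicalSpace P] [ChartedSpace E_P P] [Group G] [MulAction Gᵐᵒᵖ P] where
  /-- The bundle projection `τ : P → M`. -/
  proj : C^∞⟮𝓘(ℝ, E_P), P; 𝓘(ℝ, E_M), M⟯
  isPrincipalBundle : IsPrincipalBundle (G := G) 𝓘(ℝ, E_P) 𝓘(ℝ, E_M) 𝓘(ℝ, E_G) proj

namespace PrincipalBundle

variable {E_M E_G E_P M G P : Type*}
  [NormedAddCommGroup E_M] [NormedSpace ℝ E_M] [NormedAddCommGroup E_G] [NormedSpace ℝ E_G]
  [NormedAddCommGroup E_P] [NormedSpace ℝ E_P]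
  [TopologicalSpace M] [ChartedSpace E_M M] [IsManifold 𝓘(ℝ, E_M) ∞ M]
  [TopologicalSpace G] [ChartedSpace E_G G] [Group G]
  [TopologicalSpace P] [ChartedSpace E_P P] [IsManifold 𝓘(ℝ, E_P) ∞ P] [MulAction Gᵐᵒᵖ P]
  (B : PrincipalBundle E_M E_G E_P M G P)

/-- The fibre `T_{τ(p)}M` of `τ^*TM` is an additive group. -/
instance (p : P) : AddCommGroup ((B.proj *ᵖ (TangentSpace 𝓘(ℝ, E_M) : M → Type _)) p) :=
  inferInstanceAs (AddCommGroup (TangentSpace 𝓘(ℝ, E_M) (B.proj p)))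

/-- The total space of the vector bundle `Hom(τ^*TM, TP) → P`: pairs of a point `p : P` and a
linear map `T_{τ(p)}M → T_pP`. It carries Mathlib's topology and smooth structure of a
Hom-bundle. -/
abbrev HomBundle : Type _ :=
  Bundle.TotalSpace (E_M →L[ℝ] E_P)
    (fun p : P => (B.proj *ᵖ (TangentSpace 𝓘(ℝ, E_M) : M → Type _)) p →L[ℝ]
      (TangentSpace 𝓘(ℝ, E_P) p : Type _))

/-- The derivative `T_pτ : T_pP → T_{τ(p)}M`. -/
def tangentProj (p : P) : TangentSpace 𝓘(ℝ, E_P) p →L[ℝ] TangentSpace 𝓘(ℝ, E_M) (B.proj p) :=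
  mfderiv 𝓘(ℝ, E_P) 𝓘(ℝ, E_M) B.proj p

/-- The first jet space `J¹P`: linear maps `ρ : T_{τ(p)}M → T_pP` with `T_pτ ∘ ρ = id`, as a
subset of `Hom(τ^*TM, TP)` (with the subspace topology). -/
def J1 : Type _ :=
  {ρ : B.HomBundle // ∀ v : TangentSpace 𝓘(ℝ, E_M) (B.proj ρ.1), B.tangentProj ρ.1 (ρ.2 v) = v}

instance : TopologicalSpace B.J1 :=
  inferInstanceAs (TopologicalSpace {ρ : B.HomBundle //
    ∀ v : TangentSpace 𝓘(ℝ, E_M) (B.proj ρ.1), B.tangentProj ρ.1 (ρ.2 v) = v})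

/-- The inclusion `J¹P ⊆ Hom(τ^*TM, TP)`. -/
def incl (ρ : B.J1) : B.HomBundle := ρ.1

/-- `τ₁₀ : J¹P → P`. -/
def tau10 (ρ : B.J1) : P := (B.incl ρ).1

/-- `τ₁ : J¹P → M`. -/
def tau1 (ρ : B.J1) : M := B.proj (B.tau10 ρ)

/-- The push-forward `ρ ↦ T_pf ∘ ρ` of jets by a fibre-preserving smooth map `f : P → P`. Here
`T_{τ(p)}M` and `T_{τ(f(p))}M` are the same space, as `τ(f(p)) = τ(p)`. -/
def mapJet (f : P → P) (hf : ContMDiff 𝓘(ℝ, E_P) 𝓘(ℝ, E_P) ∞ f)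
    (hproj : ∀ p, B.proj (f p) = B.proj p) (ρ : B.J1) : B.J1 :=
  ⟨⟨f (B.tau10 ρ), ((mfderiv 𝓘(ℝ, E_P) 𝓘(ℝ, E_P) f (B.tau10 ρ) : E_P →L[ℝ] E_P).comp
      ((B.incl ρ).2 : E_M →L[ℝ] E_P) : E_M →L[ℝ] E_P)⟩, by
    intro v
    have h1 : mfderiv 𝓘(ℝ, E_P) 𝓘(ℝ, E_M) (fun q => B.proj (f q)) (B.tau10 ρ) =
        (mfderiv 𝓘(ℝ, E_P) 𝓘(ℝ, E_M) B.proj (f (B.tau10 ρ))).comp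
          (mfderiv 𝓘(ℝ, E_P) 𝓘(ℝ, E_P) f (B.tau10 ρ)) :=
      mfderiv_comp (B.tau10 ρ) (B.proj.contMDiff.mdifferentiable (by simp) _)
        (hf.mdifferentiable (by simp) _)
    have h2 : (fun q => B.proj (f q)) = B.proj := funext hproj
    have h3 := ρ.2 v
    have h4 : (mfderiv 𝓘(ℝ, E_P) 𝓘(ℝ, E_M) (fun q => B.proj (f q)) (B.tau10 ρ) : E_P →L[ℝ] E_M) =
        (mfderiv 𝓘(ℝ, E_P) 𝓘(ℝ, E_M) B.proj (B.tau10 ρ) : E_P →L[ℝ] E_M) := by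
      rw [h2]
    have h5 := congrArg (fun L : E_P →L[ℝ] E_M => L ((B.incl ρ).2 v)) (h1.symm.trans h4)
    exact h5.trans h3⟩

theorem contMDiff_translate (B : PrincipalBundle E_M E_G E_P M G P) (g : G) :
    ContMDiff 𝓘(ℝ, E_P) 𝓘(ℝ, E_P) ∞ (fun p : P => p <• g) :=
  B.isPrincipalBundle.contMDiff_act.comp (contMDiff_id.prodMk contMDiff_const)

theorem mapJet_congr {f f' : P → P} (h : f = f') (hf) (hproj) (hf') (hproj') (ρ : B.J1) :
    B.mapJet f hf hproj ρ = B.mapJet f' hf' hproj' ρ := by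
  subst h; rfl

theorem mapJet_id (hf) (hproj) (ρ : B.J1) : B.mapJet id hf hproj ρ = ρ := by
  apply Subtype.ext
  have : (mfderiv 𝓘(ℝ, E_P) 𝓘(ℝ, E_P) (id : P → P) (B.tau10 ρ) : E_P →L[ℝ] E_P) =
    ContinuousLinearMap.id ℝ E_P := mfderiv_id
  unfold mapJet
  simp only [this]
  rfl

theorem mapJet_comp {f f' : P → P} (hf) (hproj) (hf') (hproj') (hff) (hpp) (ρ : B.J1) :
    B.mapJet (f' ∘ f) hff hpp ρ = B.mapJet f' hf' hproj' (B.mapJet f hf hproj ρ) := by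
  apply Subtype.ext
  have : (mfderiv 𝓘(ℝ, E_P) 𝓘(ℝ, E_P) (f' ∘ f) (B.tau10 ρ) : E_P →L[ℝ] E_P) =
      (mfderiv 𝓘(ℝ, E_P) 𝓘(ℝ, E_P) f' (f (B.tau10 ρ)) : E_P →L[ℝ] E_P).comp
        (mfderiv 𝓘(ℝ, E_P) 𝓘(ℝ, E_P) f (B.tau10 ρ) : E_P →L[ℝ] E_P) :=
    mfderiv_comp (B.tau10 ρ) (hf'.mdifferentiable (by simp) _) (hf.mdifferentiable (by simp) _)
  unfold mapJet
  simp only [this]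
  rfl

/-- The lift of the right `G`-action to `J¹P`: `ρ · g = T_pR_g ∘ ρ`, where `R_g(p) = p · g`. -/
instance : MulAction Gᵐᵒᵖ B.J1 where
  smul a ρ := B.mapJet (fun p => p <• a.unop) (B.contMDiff_translate a.unop)
    (fun p => B.isPrincipalBundle.proj_act p a.unop) ρ
  one_smul ρ := (B.mapJet_congr (funext fun p => one_smul Gᵐᵒᵖ p) _ _ contMDiff_id
    (fun _ => rfl) ρ).trans (B.mapJet_id _ _ ρ)
  mul_smul a b ρ := (B.mapJet_congr (funext fun p => mul_smul a b p) _ _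
    ((B.contMDiff_translate a.unop).comp (B.contMDiff_translate b.unop))
    (fun p => (B.isPrincipalBundle.proj_act _ a.unop).trans
      (B.isPrincipalBundle.proj_act p b.unop)) ρ).trans (B.mapJet_comp _ _ _ _ _ _ ρ)

theorem tau10_act (ρ : B.J1) (g : G) : B.tau10 (ρ <• g) = B.tau10 ρ <• g := rfl

theorem tau1_act (ρ : B.J1) (g : G) : B.tau1 (ρ <• g) = B.tau1 ρ :=
  B.isPrincipalBundle.proj_act (B.tau10 ρ) g

/-- The orbit space `C(P) = J¹P/G` (with the quotient topology), the bundle of connections. -/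
def C : Type _ := Quotient (MulAction.orbitRel Gᵐᵒᵖ B.J1)

instance : TopologicalSpace B.C :=
  inferInstanceAs (TopologicalSpace (Quotient (MulAction.orbitRel Gᵐᵒᵖ B.J1)))

/-- The orbit projection `p_G : J¹P → J¹P/G`, `ρ ↦ [ρ]_G`. -/
def toC (ρ : B.J1) : B.C := Quotient.mk (MulAction.orbitRel Gᵐᵒᵖ B.J1) ρ

/-- The projection `p : J¹P/G → M`, `[ρ]_G ↦ τ₁(ρ)`. -/
def projC : B.C → M :=
  Quotient.lift B.tau1 (by
    rintro _ ρ ⟨a, rfl⟩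
    exact B.tau1_act ρ a.unop)

/-- The pullback bundle `p^*P = {(c, u) ∈ J¹P/G × P : p(c) = τ(u)}` (with the subspace topology of
the product). -/
def Pullback : Type _ := {q : B.C × P // B.projC q.1 = B.proj q.2}

instance : TopologicalSpace B.Pullback :=
  inferInstanceAs (TopologicalSpace {q : B.C × P // B.projC q.1 = B.proj q.2})

/-- The inclusion `p^*P ⊆ J¹P/G × P`. -/
def pullbackIncl (q : B.Pullback) : B.C × P := q.1

/-- The projection `p₁ : p^*P → J¹P/G`. -/
def pullbackProj (q : B.Pullback) : B.C := (B.pullbackIncl q).1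

/-- The right `G`-action on `p^*P`: `(c, u) · g = (c, u · g)`. -/
instance : MulAction Gᵐᵒᵖ B.Pullback where
  smul a q := ⟨(q.1.1, q.1.2 <• a.unop),
    q.2.trans (B.isPrincipalBundle.proj_act q.1.2 a.unop).symm⟩
  one_smul q := Subtype.ext (Prod.ext rfl (one_smul Gᵐᵒᵖ q.1.2))
  mul_smul a b q := Subtype.ext (Prod.ext rfl (mul_smul a b q.1.2))

/-- The map `J¹P → p^*P`, `ρ ↦ ([ρ]_G, τ₁₀(ρ))`. -/
def toPullback (ρ : B.J1) : B.Pullback := ⟨(B.toC ρ, B.tau10 ρ), rfl⟩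

/-- `s` is a smooth section of `τ : P → M` on a neighbourhood of `x`. -/
def IsLocalSectionAt (s : M → P) (x : M) : Prop :=
  ∃ U : Set M, IsOpen U ∧ x ∈ U ∧ ContMDiffOn 𝓘(ℝ, E_M) 𝓘(ℝ, E_P) ∞ s U ∧
    ∀ y ∈ U, B.proj (s y) = y

/-- The `1`-jet `j¹_x s` of a local section `s` at `x`, that is the derivative
`T_xs : T_xM → T_{s(x)}P`, where `x = τ(s(x))`. -/
def jet (s : M → P) (x : M) (hs : B.IsLocalSectionAt s x) : B.J1 :=
  ⟨⟨s x, (mfderiv 𝓘(ℝ, E_M) 𝓘(ℝ, E_P) s x : E_M →L[ℝ] E_P)⟩, by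
    obtain ⟨U, hU, hx, hs, hsec⟩ := hs
    intro v
    have hd : MDifferentiableAt 𝓘(ℝ, E_M) 𝓘(ℝ, E_P) s x :=
      (hs.contMDiffAt (hU.mem_nhds hx)).mdifferentiableAt (by simp)
    have h1 : mfderiv 𝓘(ℝ, E_M) 𝓘(ℝ, E_M) (fun y => B.proj (s y)) x =
        (mfderiv 𝓘(ℝ, E_P) 𝓘(ℝ, E_M) B.proj (s x)).comp
          (mfderiv 𝓘(ℝ, E_M) 𝓘(ℝ, E_P) s x) :=
      mfderiv_comp x (B.proj.contMDiff.mdifferentiable (by simp) _) hd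
    have h2 : (fun y => B.proj (s y)) =ᶠ[𝓝 x] id :=
      Filter.eventually_of_mem (hU.mem_nhds hx) hsec
    have h3 : (mfderiv 𝓘(ℝ, E_M) 𝓘(ℝ, E_M) (fun y => B.proj (s y)) x : E_M →L[ℝ] E_M) =
        ContinuousLinearMap.id ℝ E_M :=
      h2.mfderiv_eq.trans mfderiv_id
    exact congrArg (fun L : E_M →L[ℝ] E_M => L v) (h1.symm.trans h3)⟩

/-- The model vector space of `J¹P` and of `p^*P`: in a chart of `M` and a trivialization of `P`,
`J¹P` has coordinates `(x, g, A)` with `A : T_xM → T_gG`. -/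
abbrev ModelJ1 (E_M E_G : Type*) [NormedAddCommGroup E_M] [NormedSpace ℝ E_M]
    [NormedAddCommGroup E_G] [NormedSpace ℝ E_G] : Type _ :=
  E_M × E_G × (E_M →L[ℝ] E_G)

/-- The model vector space of `J¹P/G`. -/
abbrev ModelC (E_M E_G : Type*) [NormedAddCommGroup E_M] [NormedSpace ℝ E_M]
    [NormedAddCommGroup E_G] [NormedSpace ℝ E_G] : Type _ :=
  E_M × (E_M →L[ℝ] E_G)

/-- The given atlases define the standard smooth structures: `J¹P` is an embedded submanifold of
`Hom(τ^*TM, TP)`, `J¹P/G` is the quotient manifold (`p_G` is a submersion onto it), and `p^*P` is an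
embedded submanifold of `J¹P/G × P`. Each of these properties determines the smooth structure
uniquely. -/
structure IsStandardSmoothStructure [ChartedSpace (ModelJ1 E_M E_G) B.J1]
    [ChartedSpace (ModelC E_M E_G) B.C] [ChartedSpace (ModelJ1 E_M E_G) B.Pullback] : Prop where
  isManifold_J1 : IsManifold 𝓘(ℝ, ModelJ1 E_M E_G) ∞ B.J1
  isManifold_C : IsManifold 𝓘(ℝ, ModelC E_M E_G) ∞ B.C
  isManifold_pullback : IsManifold 𝓘(ℝ, ModelJ1 E_M E_G) ∞ B.Pullback
  isSmoothEmbedding_incl : Manifold.IsSmoothEmbedding 𝓘(ℝ, ModelJ1 E_M E_G)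
    (𝓘(ℝ, E_P).prod 𝓘(ℝ, E_M →L[ℝ] E_P)) ∞ B.incl
  isSubmersion_toC : Manifold.IsSubmersion 𝓘(ℝ, ModelJ1 E_M E_G) 𝓘(ℝ, ModelC E_M E_G) ∞ B.toC
  isSmoothEmbedding_pullbackIncl : Manifold.IsSmoothEmbedding 𝓘(ℝ, ModelJ1 E_M E_G)
    (𝓘(ℝ, ModelC E_M E_G).prod 𝓘(ℝ, E_P)) ∞ B.pullbackIncl

end PrincipalBundle

end

/-! A local trivialization `φ` of `P` over `U` gives every jet over `U` a `G`-component, that of its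
base point (`gauge`). It is multiplied by `g` on the right when the jet is translated by `g`, so
each orbit over `U` contains exactly one jet with `G`-component `1` (`normalize`). Hence `J¹P` over
`U` is the product of the normalized jets with `G`. Over a chart of `M`, a normalized jet has
coordinates `(x, A)` with `A : E_M →L[ℝ] E_G`; these become the charts of the orbit space, in which
`p_G` is a linear projection (`exists_jetTrivialization`, `exists_isSubmersion_of_isEquivariant`).

The manifold structures of `J¹P` and `p^*P` come from slice charts
(`exists_isSmoothEmbedding_of_isSlice`). In charts adapted to `τ`, the condition `Tτ ∘ ρ = id`
prescribes the `E_M`-block of a matrix and leaves the `E_G`-block free. The condition `p(c) = τ(u)`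
is the vanishing of a difference of `E_M`-coordinates.

The map `ρ ↦ ([ρ], τ₁₀(ρ))` is bijective because orbit and base point determine the jet: over `U` it
is the normalized jet of the orbit, translated by the `G`-component of `u`. The same formula is the
local inverse, and it is smooth because the normalized representative depends smoothly on the orbit.

The bundle statements hold for any atlases with the standard properties. They use only that
smoothness into an embedded submanifold is tested in the ambient manifold, and that smoothness
descends along submersions (`IsSmoothEmbedding.contMDiffAt_iff`,
`ContMDiffAt.of_comp_isSubmersionAt`). -/

noncomputable section

/-! ### Submersions, embeddings and charts as partial diffeomorphisms -/

section ManifoldTools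

open Set Function Manifold

variable {E E' E'' H H' H'' M N N' : Type*}
  [NormedAddCommGroup E] [NormedSpace ℝ E] [TopologicalSpace H]
  [NormedAddCommGroup E'] [NormedSpace ℝ E'] [TopologicalSpace H']
  [NormedAddCommGroup E''] [NormedSpace ℝ E''] [TopologicalSpace H'']
  {I : ModelWithCorners ℝ E H} {J : ModelWithCorners ℝ E' H'} {J' : ModelWithCorners ℝ E'' H''}
  [TopologicalSpace M] [ChartedSpace H M] [TopologicalSpace N] [ChartedSpace H' N]
  [TopologicalSpace N'] [ChartedSpace H'' N'] {n : WithTop ℕ∞}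

/-- A submersion has a `C^n` local section through every point. -/
theorem Manifold.IsSubmersionAt.exists_localSection [I.Boundaryless] {q : M → N} {x : M}
    (hq : IsSubmersionAt I J n q x) :
    ∃ σ : N → M, ContMDiffAt J I n σ (q x) ∧ σ (q x) = x ∧ ∀ᶠ y in 𝓝 (q x), q (σ y) = y := by
  set d := hq.domChart with hd
  set c := hq.codChart with hc
  have hxd : x ∈ d.source := hq.mem_domChart_source
  have hxc : q x ∈ c.source := hq.mem_codChart_source
  have hdx : (d.extend I) x ∈ (d.extend I).target := (d.extend I).map_source (by simpa using hxd)
  have hw := hq.writtenInCharts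
  have hback : (d.extend I).symm ((d.extend I) x) = x := d.extend_left_inv hxd
  -- In submersion charts the section is `y ↦ (y, v)`: the complementary coordinate is frozen at its
  -- value at `x`, so that the section passes through `x`.
  let v := (hq.equiv ((d.extend I) x)).2
  let w : N → E := fun y => hq.equiv.symm ((c.extend J) y, v)
  have hwx : w (q x) = (d.extend I) x := by
    have h := hw hdx
    simp only [comp_apply] at h
    rw [← hd, hback] at h
    simp only [w]
    rw [ContinuousLinearEquiv.symm_apply_eq]
    exact Prod.ext h rfl
  have hwsm : ContMDiffAt J 𝓘(ℝ, E) n w (q x) := by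
    have h1 : ContMDiffAt J 𝓘(ℝ, E') n (c.extend J) (q x) :=
      c.contMDiffAt_extend hq.codChart_mem_maximalAtlas hxc
    have h2 : ContMDiffAt J 𝓘(ℝ, E' × hq.complement) n (fun y => ((c.extend J) y, v)) (q x) :=
      h1.prodMk_space contMDiffAt_const
    exact (hq.equiv.symm.contDiff.contMDiff.contMDiffAt).comp _ h2
  have hopen : IsOpen (d.extend I).target := d.isOpen_extend_target
  have hnear : ∀ᶠ y in 𝓝 (q x), w y ∈ (d.extend I).target :=
    hwsm.continuousAt.eventually_mem (by rw [hwx]; exact hopen.mem_nhds hdx)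
  refine ⟨fun y => (d.extend I).symm (w y), ?_, ?_, ?_⟩
  · have h1 : ContMDiffAt 𝓘(ℝ, E) I n (d.extend I).symm (w (q x)) := by
      have h2 := contMDiffOn_extend_symm hq.domChart_mem_maximalAtlas
      rw [I.image_eq, ← OpenPartialHomeomorph.extend_target, ← hd] at h2
      exact h2.contMDiffAt (by rw [hwx]; exact hopen.mem_nhds hdx)
    exact h1.comp _ hwsm
  · simp only [hwx, hback]
  · filter_upwards [hnear, c.open_source.mem_nhds hxc] with y hy hyc
    have h := hw hy
    simp only [comp_apply] at h
    rw [← hd, ← hc] at h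
    simp only [w, ContinuousLinearEquiv.apply_symm_apply] at h
    have hs : (d.extend I).symm (w y) ∈ d.source := by
      have := (d.extend I).map_target hy
      simpa using this
    exact (c.extend J).injOn (by simpa using hq.source_subset_preimage_source hs)
      (by simpa using hyc) h

/-- Smoothness of a map descends along submersions. -/
theorem ContMDiffAt.of_comp_isSubmersionAt [I.Boundaryless] {q : M → N} {x : M} {f : N → N'}
    (hq : IsSubmersionAt I J n q x) (hf : ContMDiffAt I J' n (f ∘ q) x) :
    ContMDiffAt J J' n f (q x) := by
  obtain ⟨σ, hσ, hx, hev⟩ := hq.exists_localSection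
  have h : ContMDiffAt J J' n ((f ∘ q) ∘ σ) (q x) := ContMDiffAt.comp _ (by rwa [hx]) hσ
  exact h.congr_of_eventuallyEq (hev.mono fun y hy => by simp [hy])

/-- A map into an embedded submanifold is smooth if it is smooth as a map into the ambient
manifold. -/
theorem Manifold.IsSmoothEmbedding.contMDiffAt_iff {i : N → N'}
    (hi : IsSmoothEmbedding J J' n i) {f : M → N} {x : M} :
    ContMDiffAt I J n f x ↔ ContMDiffAt I J' n (i ∘ f) x := by
  rw [ContMDiffAt.iff_comp_isImmersionAt (hi.isImmersion.isImmersionAt (f x))]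
  -- The criterion for immersions also asks for continuity of `f`, which the embedding supplies.
  exact ⟨And.right, fun h => ⟨hi.isEmbedding.isInducing.continuousAt_iff.2 h.continuousAt, h⟩⟩

theorem Manifold.IsSmoothEmbedding.contMDiff_iff {i : N → N'}
    (hi : IsSmoothEmbedding J J' n i) {f : M → N} :
    ContMDiff I J n f ↔ ContMDiff I J' n (i ∘ f) :=
  forall_congr' fun _ => hi.contMDiffAt_iff

/-- A partial diffeomorphism onto an open subset of the model vector space, as a chart. -/
def PartialDiffeomorph.toChart [J.Boundaryless] (Φ : PartialDiffeomorph J 𝓘(ℝ, E') N E' n) :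
    OpenPartialHomeomorph N H' :=
  Φ.toOpenPartialHomeomorph.transHomeomorph J.toHomeomorph.symm

theorem PartialDiffeomorph.toChart_source [J.Boundaryless]
    (Φ : PartialDiffeomorph J 𝓘(ℝ, E') N E' n) : Φ.toChart.source = Φ.source := rfl

/-- A chart must take values in `H'`, so `toChart` composes with the inverse of `J`; `extend` undoes
this. -/
theorem PartialDiffeomorph.toChart_extend_apply [J.Boundaryless]
    (Φ : PartialDiffeomorph J 𝓘(ℝ, E') N E' n) (x : N) :
    Φ.toChart.extend J x = Φ x := J.toHomeomorph.apply_symm_apply (Φ x)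

theorem PartialDiffeomorph.toChart_extend_symm_apply [J.Boundaryless]
    (Φ : PartialDiffeomorph J 𝓘(ℝ, E') N E' n) (y : E') :
    (Φ.toChart.extend J).symm y = Φ.symm y :=
  congrArg Φ.symm (J.toHomeomorph.apply_symm_apply y)

theorem PartialDiffeomorph.toChart_extend_target [J.Boundaryless]
    (Φ : PartialDiffeomorph J 𝓘(ℝ, E') N E' n) :
    (Φ.toChart.extend J).target = Φ.target := by
  ext y
  rw [OpenPartialHomeomorph.extend_target]
  simp only [J.range_eq_univ, inter_univ, mem_preimage]
  show J (J.symm y) ∈ Φ.target ↔ _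
  rw [J.right_inv (by simp [J.range_eq_univ])]

/-- This makes `Φ` usable in `mk_of_charts` for immersions and submersions. -/
theorem PartialDiffeomorph.toChart_mem_maximalAtlas [J.Boundaryless] [IsManifold J n N]
    (Φ : PartialDiffeomorph J 𝓘(ℝ, E') N E' n) :
    Φ.toChart ∈ IsManifold.maximalAtlas J n N := by
  apply OpenPartialHomeomorph.mem_maximalAtlas_of_contMDiffOn
  · have h : ContMDiffOn 𝓘(ℝ, E') J n J.symm (range J) := J.contMDiffOn_symm
    exact h.comp Φ.contMDiffOn_toFun (fun x _ => by simp [J.range_eq_univ])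
  · exact Φ.contMDiffOn_invFun.comp J.contMDiff.contMDiffOn (fun x hx => hx)

/-- The model vector space of a manifold is isomorphic to the model of any local diffeomorph. -/
def PartialDiffeomorph.modelEquiv (Φ : PartialDiffeomorph I J M N n) (hn : n ≠ 0) {x : M}
    (hx : x ∈ Φ.source) : E ≃L[ℝ] E' :=
  (show IsLocalDiffeomorphAt I J n Φ x from
    ⟨Φ, hx, Set.eqOn_refl _ _⟩).mfderivToContinuousLinearEquiv hn

/-- A continuous linear equivalence as a partial diffeomorphism. -/
def ContinuousLinearEquiv.toPartialDiffeomorph (L : E ≃L[ℝ] E') (n : WithTop ℕ∞) :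
    PartialDiffeomorph 𝓘(ℝ, E) 𝓘(ℝ, E') E E' n where
  toPartialEquiv := L.toHomeomorph.toPartialEquiv
  open_source := isOpen_univ
  open_target := isOpen_univ
  contMDiffOn_toFun := L.contDiff.contMDiff.contMDiffOn
  contMDiffOn_invFun := L.symm.contDiff.contMDiff.contMDiffOn

end ManifoldTools

end

noncomputable section

/-! ### Submanifolds from slice charts -/

section SlicesAndQuotients

open Set Function Manifold Topology

/-- A charted space structure given by a family of charts. -/
abbrev ChartedSpace.ofCharts {S A : Type*} [TopologicalSpace S] [TopologicalSpace A]
    (e : S → OpenPartialHomeomorph S A) (he : ∀ s, s ∈ (e s).source) : ChartedSpace A S where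
  atlas := range e
  chartAt := e
  mem_chart_source := he
  chart_mem_atlas := mem_range_self

theorem ChartedSpace.isManifold_ofCharts {S A : Type*} [TopologicalSpace S]
    [NormedAddCommGroup A] [NormedSpace ℝ A] {n : WithTop ℕ∞}
    (e : S → OpenPartialHomeomorph S A) (he : ∀ s, s ∈ (e s).source)
    (h : ∀ s s', ContDiffOn ℝ n ((e s).symm ≫ₕ e s') ((e s).symm ≫ₕ e s').source) :
    letI := ChartedSpace.ofCharts e he
    IsManifold 𝓘(ℝ, A) n S := by
  let _ := ChartedSpace.ofCharts e he
  apply isManifold_of_contDiffOn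
  rintro _ _ ⟨s, rfl⟩ ⟨s', rfl⟩
  simpa using h s s'

variable {E_N H_N N A K S : Type*}
  [NormedAddCommGroup E_N] [NormedSpace ℝ E_N] [TopologicalSpace H_N]
  {J : ModelWithCorners ℝ E_N H_N} [TopologicalSpace N] [ChartedSpace H_N N]
  [NormedAddCommGroup A] [NormedSpace ℝ A] [NormedAddCommGroup K] [NormedSpace ℝ K]
  [TopologicalSpace S] {n : WithTop ℕ∞}

/-- `Ψ` is a slice chart for the subspace `i : S → N`: in `Ψ`, the subspace is `A × 0`. -/
structure PartialDiffeomorph.IsSlice (Ψ : PartialDiffeomorph J 𝓘(ℝ, A × K) N (A × K) n)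
    (i : S → N) : Prop where
  snd_eq_zero : ∀ s, i s ∈ Ψ.source → (Ψ (i s)).2 = 0
  exists_eq : ∀ a, (a, (0 : K)) ∈ Ψ.target → ∃ s, i s = Ψ.symm (a, 0)

namespace PartialDiffeomorph.IsSlice

variable {Ψ Ψ' : PartialDiffeomorph J 𝓘(ℝ, A × K) N (A × K) n} {i : S → N}

open Classical in
/-- The chart of a subspace induced by a slice chart of the ambient manifold. -/
def chart (hΨ : Ψ.IsSlice i) (hi : IsEmbedding i) (s₀ : S) : OpenPartialHomeomorph S A :=
  { toFun := fun s => (Ψ (i s)).1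
    -- The point `s₀` is only a default value off the target.
    invFun := fun a => if h : (a, (0 : K)) ∈ Ψ.target then (hΨ.exists_eq a h).choose else s₀
    source := i ⁻¹' Ψ.source
    target := {a | (a, (0 : K)) ∈ Ψ.target}
    map_source' := by
      intro s hs
      have h := Ψ.map_source hs
      have h' : Ψ (i s) = ((Ψ (i s)).1, 0) := Prod.ext rfl (hΨ.snd_eq_zero s hs)
      show ((Ψ (i s)).1, (0 : K)) ∈ Ψ.target
      rw [← h']; exact h
    map_target' := by
      intro a ha
      have ha' : (a, (0 : K)) ∈ Ψ.target := ha
      simp only [ha', dif_pos, mem_preimage]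
      rw [(hΨ.exists_eq a ha').choose_spec]
      exact Ψ.map_target ha'
    left_inv' := by
      intro s hs
      have h' : Ψ (i s) = ((Ψ (i s)).1, 0) := Prod.ext rfl (hΨ.snd_eq_zero s hs)
      have ha' : ((Ψ (i s)).1, (0 : K)) ∈ Ψ.target := h' ▸ Ψ.map_source hs
      simp only [ha', dif_pos]
      apply hi.injective
      rw [(hΨ.exists_eq _ ha').choose_spec, ← h']
      exact Ψ.left_inv hs
    right_inv' := by
      intro a ha
      have ha' : (a, (0 : K)) ∈ Ψ.target := ha
      simp only [ha', dif_pos]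
      rw [(hΨ.exists_eq a ha').choose_spec]
      exact congrArg Prod.fst (Ψ.right_inv ha')
    open_source := Ψ.open_source.preimage hi.continuous
    open_target := Ψ.open_target.preimage (by fun_prop : Continuous fun a : A => (a, (0 : K)))
    continuousOn_toFun := continuous_fst.comp_continuousOn
      (Ψ.contMDiffOn.continuousOn.comp hi.continuous.continuousOn fun s hs => hs)
    continuousOn_invFun := by
      -- The inverse is defined by choice, but after `i` it is `Ψ.symm (a, 0)`, so continuity is
      -- tested there.
      rw [hi.isInducing.continuousOn_iff]
      have h : ContinuousOn (fun a : A => Ψ.symm (a, (0 : K))) {a | (a, (0 : K)) ∈ Ψ.target} :=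
        Ψ.symm.contMDiffOn.continuousOn.comp (by fun_prop) fun a ha => ha
      refine h.congr fun a ha => ?_
      have ha' : (a, (0 : K)) ∈ Ψ.target := ha
      simp only [comp_apply, ha', dif_pos]
      exact (hΨ.exists_eq a ha').choose_spec }

open Classical in
theorem chart_symm (hΨ : Ψ.IsSlice i) (hi : IsEmbedding i) (s₀ : S) {a : A}
    (ha : a ∈ (hΨ.chart hi s₀).target) : i ((hΨ.chart hi s₀).symm a) = Ψ.symm (a, 0) := by
  have ha' : (a, (0 : K)) ∈ Ψ.target := ha
  show i (dite _ _ _) = _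
  rw [dif_pos ha']
  exact (hΨ.exists_eq a ha').choose_spec

/-- The transition map is `a ↦ (Ψ' (Ψ.symm (a, 0))).1`, the ambient transition restricted to the
slice. -/
theorem contDiffOn_transition (hΨ : Ψ.IsSlice i) (hΨ' : Ψ'.IsSlice i) (hi : IsEmbedding i)
    (s₀ s₁ : S) : ContDiffOn ℝ n ((hΨ.chart hi s₀).symm ≫ₕ hΨ'.chart hi s₁)
      ((hΨ.chart hi s₀).symm ≫ₕ hΨ'.chart hi s₁).source := by
  apply ContMDiffOn.contDiffOn
  intro a ha
  have ha1 : a ∈ (hΨ.chart hi s₀).target := ha.1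
  have ha2 : i ((hΨ.chart hi s₀).symm a) ∈ Ψ'.source := ha.2
  have ha1' : (a, (0 : K)) ∈ Ψ.target := ha1
  rw [chart_symm hΨ hi s₀ ha1] at ha2
  have h1 : ContMDiffAt 𝓘(ℝ, A) 𝓘(ℝ, A × K) n (fun a : A => (a, (0 : K))) a :=
    ContDiff.contMDiff (by fun_prop) a
  have h2 : ContMDiffAt 𝓘(ℝ, A × K) J n Ψ.symm (a, 0) :=
    Ψ.symm.contMDiffOn.contMDiffAt (Ψ.open_target.mem_nhds ha1')
  have h3 : ContMDiffAt J 𝓘(ℝ, A × K) n Ψ' (Ψ.symm (a, 0)) :=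
    Ψ'.contMDiffOn.contMDiffAt (Ψ'.open_source.mem_nhds ha2)
  have h4 : ContMDiffAt 𝓘(ℝ, A × K) 𝓘(ℝ, A) n Prod.fst (Ψ' (Ψ.symm (a, 0))) :=
    ContDiff.contMDiff (by fun_prop) _
  have h5 : ContMDiffAt 𝓘(ℝ, A) 𝓘(ℝ, A) n (fun a : A => (Ψ' (Ψ.symm (a, (0 : K)))).1) a :=
    h4.comp a (h3.comp (f := fun a : A => Ψ.symm (a, (0 : K))) a
      (h2.comp (f := fun a : A => (a, (0 : K))) a h1))
  refine (h5.congr_of_eventuallyEq ?_).contMDiffWithinAt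
  filter_upwards [(hΨ.chart hi s₀).open_target.mem_nhds ha1] with b hb
  show (Ψ' (i ((hΨ.chart hi s₀).symm b))).1 = _
  rw [chart_symm hΨ hi s₀ hb]

end PartialDiffeomorph.IsSlice

/-- A subspace covered by slice charts is an embedded submanifold. -/
theorem exists_isSmoothEmbedding_of_isSlice [J.Boundaryless] [IsManifold J n N] (hn : n ≠ 0)
    {i : S → N} (hi : IsEmbedding i)
    (h : ∀ s, ∃ Ψ : PartialDiffeomorph J 𝓘(ℝ, A × K) N (A × K) n, i s ∈ Ψ.source ∧ Ψ.IsSlice i) :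
    ∃ _ : ChartedSpace A S, IsManifold 𝓘(ℝ, A) n S ∧ IsSmoothEmbedding 𝓘(ℝ, A) J n i := by
  choose Ψ hs hΨ using h
  let e : S → OpenPartialHomeomorph S A := fun s => (hΨ s).chart hi s
  let _ : ChartedSpace A S := ChartedSpace.ofCharts e hs
  have : IsManifold 𝓘(ℝ, A) n S :=
    ChartedSpace.isManifold_ofCharts e hs fun s s' => (hΨ s).contDiffOn_transition (hΨ s') hi s s'
  refine ⟨inferInstance, inferInstance, ?_, hi⟩
  suffices IsImmersionOfComplement K 𝓘(ℝ, A) J n i from this.isImmersion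
  intro s
  -- Charts of `N` are modelled on `E_N`, not on `A × K`. The derivative of `Ψ s` at `i s`
  -- identifies the two; following `Ψ s` by the inverse of this derivative gives an admissible
  -- chart.
  let L : (A × K) ≃L[ℝ] E_N := ((Ψ s).modelEquiv hn (hs s)).symm
  let Φ : PartialDiffeomorph J 𝓘(ℝ, E_N) N E_N n :=
    (Ψ s).trans (L.toPartialDiffeomorph n)
  have hΦ : ∀ x, Φ x = L (Ψ s x) := fun x => rfl
  have hsrc : Φ.source = (Ψ s).source := by
    show (Ψ s).source ∩ _ ⁻¹' univ = _
    simp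
  refine IsImmersionAtOfComplement.mk_of_charts L (e s) Φ.toChart (hs s) ?_
    (IsManifold.chart_mem_maximalAtlas s) Φ.toChart_mem_maximalAtlas ?_ ?_
  · rw [Φ.toChart_source, hsrc]; exact hs s
  · rw [Φ.toChart_source, hsrc]; exact fun s hs => hs
  · intro a ha
    have ha' : a ∈ (e s).target := by simpa using ha
    have ha'' : (a, (0 : K)) ∈ (Ψ s).target := ha'
    have hsymm : i ((e s).symm a) = (Ψ s).symm (a, 0) := (hΨ s).chart_symm hi s ha'
    show Φ.toChart.extend J (i ((e s).symm a)) = L (a, 0)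
    rw [Φ.toChart_extend_apply, hΦ, hsymm]
    exact congrArg L ((Ψ s).right_inv ha'')

/-! ### Orbit spaces of locally trivial actions -/

section Quotient

variable {E_X H_X X E_G H_G G Y : Type*}
  [NormedAddCommGroup E_X] [NormedSpace ℝ E_X] [TopologicalSpace H_X]
  {I_X : ModelWithCorners ℝ E_X H_X} [TopologicalSpace X] [ChartedSpace H_X X]
  [NormedAddCommGroup E_G] [NormedSpace ℝ E_G] [TopologicalSpace H_G]
  {I_G : ModelWithCorners ℝ E_G H_G} [TopologicalSpace G] [ChartedSpace H_G G]
  [Group G] [MulAction Gᵐᵒᵖ X] [TopologicalSpace Y]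

/-- `Θ` is an equivariant partial diffeomorphism from an invariant open subset of `X` to `O × G`,
`O` an open subset of a vector space. -/
structure PartialDiffeomorph.IsEquivariant
    (Θ : PartialDiffeomorph I_X (𝓘(ℝ, A).prod I_G) X (A × G) n) : Prop where
  target_eq : ∃ O : Set A, Θ.target = O ×ˢ univ
  act_mem : ∀ x ∈ Θ.source, ∀ g : G, x <• g ∈ Θ.source
  map_act : ∀ x ∈ Θ.source, ∀ g : G, Θ (x <• g) = ((Θ x).1, (Θ x).2 * g)

namespace PartialDiffeomorph.IsEquivariant

variable {Θ Θ' : PartialDiffeomorph I_X (𝓘(ℝ, A).prod I_G) X (A × G) n} {q : X → Y}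

theorem mem_target (hΘ : Θ.IsEquivariant) {a : A} {g h : G} (ha : (a, g) ∈ Θ.target) :
    (a, h) ∈ Θ.target := by
  obtain ⟨O, hO⟩ := hΘ.target_eq
  rw [hO] at ha ⊢
  exact ⟨ha.1, mem_univ _⟩

/-- Points with equal first coordinates differ by the group element `(Θ x).2⁻¹ * (Θ y).2`, since `Θ`
is injective. Thus the first coordinate descends to an injective coordinate on orbits. -/
theorem fst_eq_iff (hΘ : Θ.IsEquivariant) {x y : X} (hx : x ∈ Θ.source) (hy : y ∈ Θ.source) :
    (Θ x).1 = (Θ y).1 ↔ ∃ g : G, x <• g = y := by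
  constructor
  · intro h
    refine ⟨(Θ x).2⁻¹ * (Θ y).2, Θ.injOn (hΘ.act_mem x hx _) hy ?_⟩
    refine (hΘ.map_act x hx _).trans ?_
    exact Prod.ext h (by simp)
  · rintro ⟨g, rfl⟩
    rw [hΘ.map_act x hx g]

/-- The chart of the orbit space induced by an equivariant partial diffeomorphism. -/
def quotientChart (hΘ : Θ.IsEquivariant) (hq : IsOpenQuotientMap q)
    (horb : ∀ x y, q x = q y ↔ ∃ g : G, x <• g = y) : OpenPartialHomeomorph Y A := by
  -- The chosen representative of `q x` need not be near `x`, but it lies in the same orbit, hence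
  -- in the invariant source and with the same first coordinate.
  have hrep : ∀ x ∈ Θ.source, surjInv hq.surjective (q x) ∈ Θ.source ∧
      (Θ (surjInv hq.surjective (q x))).1 = (Θ x).1 := by
    intro x hx
    obtain ⟨g, hg⟩ := (horb x _).1 (surjInv_eq hq.surjective (q x)).symm
    rw [← hg]
    exact ⟨hΘ.act_mem x hx g, by rw [hΘ.map_act x hx g]⟩
  exact
  { toFun := fun y => (Θ (surjInv hq.surjective y)).1
    invFun := fun a => q (Θ.symm (a, 1))
    source := q '' Θ.source
    target := {a | (a, (1 : G)) ∈ Θ.target}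
    map_source' := by
      rintro _ ⟨x, hx, rfl⟩
      show ((Θ (surjInv hq.surjective (q x))).1, (1 : G)) ∈ Θ.target
      rw [(hrep x hx).2]
      exact hΘ.mem_target (g := (Θ x).2) (Θ.map_source hx)
    map_target' := fun a ha => ⟨_, Θ.map_target ha, rfl⟩
    left_inv' := by
      rintro _ ⟨x, hx, rfl⟩
      rw [(hrep x hx).2]
      have hm : ((Θ x).1, (1 : G)) ∈ Θ.target :=
        hΘ.mem_target (g := (Θ x).2) (Θ.map_source hx)
      refine (horb _ _).2 ((hΘ.fst_eq_iff (Θ.map_target hm) hx).1 ?_)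
      have h := congrArg Prod.fst (Θ.right_inv hm)
      exact h
    right_inv' := by
      intro a ha
      have h := (hrep _ (Θ.map_target ha)).2
      exact h.trans (congrArg Prod.fst (Θ.right_inv ha))
    open_source := hq.isOpenMap _ Θ.open_source
    open_target := Θ.open_target.preimage (by fun_prop : Continuous fun a : A => (a, (1 : G)))
    continuousOn_toFun := by
      rintro _ ⟨x, hx, rfl⟩
      apply ContinuousAt.continuousWithinAt
      -- As `q` is an open quotient map, neighbourhoods of `q x` are images of neighbourhoods of
      -- `x`, so continuity can be checked upstairs.
      rw [ContinuousAt, ← hq.map_nhds_eq, Filter.tendsto_map'_iff, (hrep x hx).2]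
      have h : ContinuousAt (fun x => (Θ x).1) x :=
        continuous_fst.continuousAt.comp
          (Θ.contMDiffOn.continuousOn.continuousAt (Θ.open_source.mem_nhds hx))
      refine h.tendsto.congr' ?_
      filter_upwards [Θ.open_source.mem_nhds hx] with z hz
      exact (hrep z hz).2.symm
    continuousOn_invFun := by
      refine hq.continuous.comp_continuousOn ?_
      exact Θ.symm.contMDiffOn.continuousOn.comp (by fun_prop) fun a ha => ha }

variable (hq : IsOpenQuotientMap q) (horb : ∀ x y, q x = q y ↔ ∃ g : G, x <• g = y)

theorem mem_source_of_mem_quotientChart_source (hΘ : Θ.IsEquivariant) {x : X}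
    (hx : q x ∈ (hΘ.quotientChart hq horb).source) : x ∈ Θ.source := by
  obtain ⟨y, hy, hyx⟩ := hx
  obtain ⟨g, rfl⟩ := (horb y x).1 hyx
  exact hΘ.act_mem y hy g

theorem quotientChart_apply (hΘ : Θ.IsEquivariant) {x : X} (hx : x ∈ Θ.source) :
    hΘ.quotientChart hq horb (q x) = (Θ x).1 := by
  obtain ⟨g, hg⟩ := (horb x _).1 (surjInv_eq hq.surjective (q x)).symm
  show (Θ (surjInv hq.surjective (q x))).1 = _
  rw [← hg, hΘ.map_act x hx g]

/-- The transition map is `a ↦ (Θ' (Θ.symm (a, 1))).1`: the smooth lift `a ↦ (a, 1)` replaces the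
choice of representatives. -/
theorem contDiffOn_transition (hΘ : Θ.IsEquivariant) (hΘ' : Θ'.IsEquivariant) :
    ContDiffOn ℝ n ((hΘ.quotientChart hq horb).symm ≫ₕ hΘ'.quotientChart hq horb)
      ((hΘ.quotientChart hq horb).symm ≫ₕ hΘ'.quotientChart hq horb).source := by
  apply ContMDiffOn.contDiffOn
  intro a ha
  have ha1 : (a, (1 : G)) ∈ Θ.target := ha.1
  have ha2 : Θ.symm (a, 1) ∈ Θ'.source :=
    hΘ'.mem_source_of_mem_quotientChart_source hq horb ha.2
  have h1 : ContMDiffAt 𝓘(ℝ, A) (𝓘(ℝ, A).prod I_G) n (fun a : A => (a, (1 : G))) a :=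
    contMDiffAt_id.prodMk contMDiffAt_const
  have h2 : ContMDiffAt (𝓘(ℝ, A).prod I_G) I_X n Θ.symm (a, 1) :=
    Θ.symm.contMDiffOn.contMDiffAt (Θ.open_target.mem_nhds ha1)
  have h3 : ContMDiffAt I_X (𝓘(ℝ, A).prod I_G) n Θ' (Θ.symm (a, 1)) :=
    Θ'.contMDiffOn.contMDiffAt (Θ'.open_source.mem_nhds ha2)
  have h23 : ContMDiffAt 𝓘(ℝ, A) I_X n (fun a : A => Θ.symm (a, (1 : G))) a :=
    h2.comp (f := fun a : A => (a, (1 : G))) a h1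
  have h5 : ContMDiffAt 𝓘(ℝ, A) 𝓘(ℝ, A) n (fun a : A => (Θ' (Θ.symm (a, (1 : G)))).1) a :=
    contMDiffAt_fst.comp a (h3.comp (f := fun a : A => Θ.symm (a, (1 : G))) a h23)
  refine (h5.congr_of_eventuallyEq ?_).contMDiffWithinAt
  filter_upwards [h23.continuousAt.eventually_mem (Θ'.open_source.mem_nhds ha2)] with b hb
  exact hΘ'.quotientChart_apply hq horb hb

end PartialDiffeomorph.IsEquivariant

/-- The orbit space of an action which is locally isomorphic to `O × G` is a manifold, and the
orbit projection is a submersion. -/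
theorem exists_isSubmersion_of_isEquivariant [I_X.Boundaryless] [I_G.Boundaryless]
    [IsManifold I_X n X] [IsManifold I_G n G] (hn : n ≠ 0) {q : X → Y} (hq : IsOpenQuotientMap q)
    (horb : ∀ x y, q x = q y ↔ ∃ g : G, x <• g = y)
    (h : ∀ x : X, ∃ Θ : PartialDiffeomorph I_X (𝓘(ℝ, A).prod I_G) X (A × G) n,
      x ∈ Θ.source ∧ Θ.IsEquivariant) :
    ∃ _ : ChartedSpace A Y, IsManifold 𝓘(ℝ, A) n Y ∧ IsSubmersion I_X 𝓘(ℝ, A) n q := by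
  choose Θ hx hΘ using h
  let r : Y → X := surjInv hq.surjective
  have hr : ∀ y, q (r y) = y := surjInv_eq hq.surjective
  let e : Y → OpenPartialHomeomorph Y A := fun y => (hΘ (r y)).quotientChart hq horb
  have he : ∀ y, y ∈ (e y).source := fun y => ⟨r y, hx (r y), hr y⟩
  let _ : ChartedSpace A Y := ChartedSpace.ofCharts e he
  have : IsManifold 𝓘(ℝ, A) n Y := ChartedSpace.isManifold_ofCharts e he fun y y' =>
    (hΘ (r y)).contDiffOn_transition hq horb (hΘ (r y'))
  refine ⟨inferInstance, inferInstance, ?_⟩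
  suffices IsSubmersionOfComplement E_G I_X 𝓘(ℝ, A) n q from this.isSubmersion
  intro x
  let y := q x
  have hxy : x ∈ (Θ (r y)).source :=
    (hΘ (r y)).mem_source_of_mem_quotientChart_source hq horb (he (q x))
  -- The second component of `Θ` lies in the manifold `G`. A chart of `G` turns `Θ` into coordinates
  -- in `A × E_G`, where `q` becomes the first projection; `L` below identifies `A × E_G` with the
  -- model of `X`.
  let κ := extChartAt I_G (Θ (r y) x).2
  have hκt : IsOpen κ.target := isOpen_extChartAt_target _
  let k : PartialDiffeomorph (𝓘(ℝ, A).prod I_G) 𝓘(ℝ, A × E_G) (A × G) (A × E_G) n :=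
    { toPartialEquiv := (PartialEquiv.refl A).prod κ
      open_source := isOpen_univ.prod (isOpen_extChartAt_source _)
      open_target := isOpen_univ.prod hκt
      contMDiffOn_toFun := by
        refine ContMDiffOn.prodMk_space contMDiffOn_fst ?_
        exact (contMDiffOn_extChartAt (I := I_G)).comp contMDiffOn_snd
          (fun p hp => by rw [← extChartAt_source I_G]; exact hp.2)
      contMDiffOn_invFun := by
        refine ContMDiffOn.prodMk
          (ContDiff.contMDiff (f := fun p : A × E_G => p.1) (by fun_prop)).contMDiffOn ?_
        exact (contMDiffOn_extChartAt_symm (I := I_G) _).comp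
          (ContDiff.contMDiff (f := fun p : A × E_G => p.2) (by fun_prop)).contMDiffOn
          (fun p hp => hp.2) }
  let Φ₀ := (Θ (r y)).trans k
  have hx0 : x ∈ Φ₀.source := ⟨hxy, mem_univ _, mem_extChartAt_source _⟩
  let L : E_X ≃L[ℝ] A × E_G := Φ₀.modelEquiv hn hx0
  let Φ : PartialDiffeomorph I_X 𝓘(ℝ, E_X) X E_X n :=
    Φ₀.trans (L.symm.toPartialDiffeomorph n)
  have hsrc : Φ.source = Φ₀.source := by
    show Φ₀.source ∩ _ ⁻¹' univ = _
    simp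
  refine IsSubmersionAtOfComplement.mk_of_charts L Φ.toChart (e y) (by rwa [Φ.toChart_source, hsrc])
    (he y) Φ.toChart_mem_maximalAtlas (IsManifold.chart_mem_maximalAtlas y) ?_ ?_
  · rw [Φ.toChart_source, hsrc]
    exact fun z hz => ⟨z, hz.1, rfl⟩
  · intro v hv
    rw [Φ.toChart_extend_target] at hv
    have hz := Φ.map_target hv
    have hzz := Φ.right_inv hv
    show (e y) (q ((Φ.toChart.extend I_X).symm v)) = _
    rw [Φ.toChart_extend_symm_apply]
    set z := Φ.symm v with hzdef
    have hz' : z ∈ (Θ (r y)).source := by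
      have : z ∈ Φ.source := hz
      rw [hsrc] at this
      exact this.1
    refine ((hΘ (r y)).quotientChart_apply hq horb hz').trans ?_
    have h1 : L.symm (k (Θ (r y) z)) = v := hzz
    show _ = (L v).1
    rw [← h1, L.apply_symm_apply]
    rfl

end Quotient

end SlicesAndQuotients

end

noncomputable section

/-! ### Smooth families of linear maps between tangent spaces -/

section TangentCoordinates

open Bundle Set Function

variable {E E' E'' E_Z H H' H'' H_Z M M' M'' Z : Type*}
  [NormedAddCommGroup E] [NormedSpace ℝ E] [TopologicalSpace H]
  [NormedAddCommGroup E'] [NormedSpace ℝ E'] [TopologicalSpace H']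
  [NormedAddCommGroup E''] [NormedSpace ℝ E''] [TopologicalSpace H'']
  [NormedAddCommGroup E_Z] [NormedSpace ℝ E_Z] [TopologicalSpace H_Z]
  {I : ModelWithCorners ℝ E H} {I' : ModelWithCorners ℝ E' H'} {I'' : ModelWithCorners ℝ E'' H''}
  {I_Z : ModelWithCorners ℝ E_Z H_Z}
  [TopologicalSpace M] [ChartedSpace H M] [IsManifold I 1 M]
  [TopologicalSpace M'] [ChartedSpace H' M'] [IsManifold I' 1 M']
  [TopologicalSpace M''] [ChartedSpace H'' M''] [IsManifold I'' 1 M'']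
  [TopologicalSpace Z] [ChartedSpace H_Z Z] {n : WithTop ℕ∞}

/-- The trivialization of the middle tangent bundle cancels against its inverse, but only over its
base set; this is the role of `hz`. -/
theorem inTangentCoordinates_comp {N : Type*} {a : N → M} {b : N → M'} {c : N → M''}
    {φ : N → E →L[ℝ] E'} {ψ : N → E' →L[ℝ] E''} {z₀ z : N}
    (hz : b z ∈ (chartAt H' (b z₀)).source) :
    inTangentCoordinates I I'' a c (fun z => (ψ z).comp (φ z)) z₀ z =
      (inTangentCoordinates I' I'' b c ψ z₀ z).comp (inTangentCoordinates I I' a b φ z₀ z) := by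
  ext v
  simp only [inTangentCoordinates, ContinuousLinearMap.inCoordinates,
    ContinuousLinearMap.comp_apply]
  congr 1
  exact congrArg (ψ z) ((trivializationAt E' (TangentSpace I' : M' → Type _)
    (b z₀)).symmL_continuousLinearMapAt hz _).symm

/-- Composition of smooth families of linear maps between tangent spaces. -/
theorem ContMDiffAt.inTangentCoordinates_comp {a : Z → M} {b : Z → M'} {c : Z → M''}
    {φ : Z → E →L[ℝ] E'} {ψ : Z → E' →L[ℝ] E''} {z₀ : Z} (hb : ContinuousAt b z₀)
    (hψ : ContMDiffAt I_Z 𝓘(ℝ, E' →L[ℝ] E'') n (inTangentCoordinates I' I'' b c ψ z₀) z₀)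
    (hφ : ContMDiffAt I_Z 𝓘(ℝ, E →L[ℝ] E') n (inTangentCoordinates I I' a b φ z₀) z₀) :
    ContMDiffAt I_Z 𝓘(ℝ, E →L[ℝ] E'') n
      (inTangentCoordinates I I'' a c (fun z => (ψ z).comp (φ z)) z₀) z₀ := by
  refine (ContMDiffAt.clm_comp hψ hφ).congr_of_eventuallyEq ?_
  filter_upwards [hb.eventually_mem (chart_source_mem_nhds H' (b z₀))] with z hz
  exact _root_.inTangentCoordinates_comp hz

theorem ContMDiffAt.inTangentCoordinates_mfderiv {f : M → M'} {a : Z → M} {z₀ : Z}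
    (hf : ContMDiffAt I I' ∞ f (a z₀)) (ha : ContMDiffAt I_Z I ∞ a z₀) :
    ContMDiffAt I_Z 𝓘(ℝ, E →L[ℝ] E') ∞
      (inTangentCoordinates I I' a (fun z => f (a z)) (fun z => mfderiv I I' f (a z)) z₀) z₀ :=
  -- Differentiation costs one order, and `∞ + 1 = ∞`.
  (hf.mfderiv_const (m := ∞) (by rfl)).comp z₀ ha

end TangentCoordinates

section PartialDiffeomorphDerivative

open Set Function

variable {E E' H H' M N : Type*}
  [NormedAddCommGroup E] [NormedSpace ℝ E] [TopologicalSpace H]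
  [NormedAddCommGroup E'] [NormedSpace ℝ E'] [TopologicalSpace H']
  {I : ModelWithCorners ℝ E H} {J : ModelWithCorners ℝ E' H'}
  [TopologicalSpace M] [ChartedSpace H M] [TopologicalSpace N] [ChartedSpace H' N]

namespace PartialDiffeomorph

variable {n : WithTop ℕ∞}

theorem contMDiffAt (Φ : PartialDiffeomorph I J M N n) {x : M} (hx : x ∈ Φ.source) :
    ContMDiffAt I J n Φ x :=
  Φ.contMDiffOn.contMDiffAt (Φ.open_source.mem_nhds hx)

theorem contMDiffAt_symm (Φ : PartialDiffeomorph I J M N n) {y : N} (hy : y ∈ Φ.target) :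
    ContMDiffAt J I n Φ.symm y :=
  Φ.symm.contMDiffAt hy

theorem mfderiv_symm_comp_mfderiv (Φ : PartialDiffeomorph I J M N n) (hn : n ≠ 0) {x : M}
    (hx : x ∈ Φ.source) :
    (mfderiv J I Φ.symm (Φ x) : E' →L[ℝ] E).comp (mfderiv I J Φ x : E →L[ℝ] E') =
      ContinuousLinearMap.id ℝ E := by
  have h1 := mfderiv_comp x ((Φ.contMDiffAt_symm (Φ.map_source hx)).mdifferentiableAt hn)
    ((Φ.contMDiffAt hx).mdifferentiableAt hn)
  refine h1.symm.trans ?_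
  have h2 : Φ.symm ∘ Φ =ᶠ[𝓝 x] id :=
    Filter.eventually_of_mem (Φ.open_source.mem_nhds hx) fun y hy => Φ.left_inv hy
  exact h2.mfderiv_eq.trans mfderiv_id

theorem mfderiv_comp_mfderiv_symm (Φ : PartialDiffeomorph I J M N n) (hn : n ≠ 0) {y : N}
    (hy : y ∈ Φ.target) :
    (mfderiv I J Φ (Φ.symm y) : E →L[ℝ] E').comp (mfderiv J I Φ.symm y : E' →L[ℝ] E) =
      ContinuousLinearMap.id ℝ E' :=
  Φ.symm.mfderiv_symm_comp_mfderiv hn hy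

theorem mfderiv_comp_mfderiv_symm' (Φ : PartialDiffeomorph I J M N n) (hn : n ≠ 0) {x : M}
    (hx : x ∈ Φ.source) :
    (mfderiv I J Φ x : E →L[ℝ] E').comp (mfderiv J I Φ.symm (Φ x) : E' →L[ℝ] E) =
      ContinuousLinearMap.id ℝ E' := by
  have h := Φ.mfderiv_comp_mfderiv_symm hn (Φ.map_source hx)
  have h' : Φ.symm (Φ x) = x := Φ.left_inv hx
  have h'' : (mfderiv I J Φ (Φ.symm (Φ x)) : E →L[ℝ] E') = mfderiv I J Φ x := by rw [h']
  rwa [h''] at h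

end PartialDiffeomorph

end PartialDiffeomorphDerivative

/-! ### Smoothness in the bundle `Hom(τ^*TM, TP)` and its charts -/

namespace PrincipalBundle

open Bundle ContinuousLinearMap Set Function

variable {E_M E_G E_P M G P : Type*}
  [NormedAddCommGroup E_M] [NormedSpace ℝ E_M] [NormedAddCommGroup E_G] [NormedSpace ℝ E_G]
  [NormedAddCommGroup E_P] [NormedSpace ℝ E_P]
  [TopologicalSpace M] [ChartedSpace E_M M] [IsManifold 𝓘(ℝ, E_M) ∞ M]
  [TopologicalSpace G] [ChartedSpace E_G G] [Group G]
  [TopologicalSpace P] [ChartedSpace E_P P] [IsManifold 𝓘(ℝ, E_P) ∞ P] [MulAction Gᵐᵒᵖ P]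
  (B : PrincipalBundle E_M E_G E_P M G P)

variable {E_Z H_Z Z : Type*} [NormedAddCommGroup E_Z] [NormedSpace ℝ E_Z] [TopologicalSpace H_Z]
  {I_Z : ModelWithCorners ℝ E_Z H_Z} [TopologicalSpace Z] [ChartedSpace H_Z Z]

/-- The trivialization of `τ^*TM` at `u₀` is pulled back from that of `TM` at `τ(u₀)`, and off the
base sets both inverses have the same default value. Smoothness in the Hom-bundle is thereby reduced
to tangent coordinates, where derivatives of maps are controlled. -/
theorem inCoordinates_pullback (u₀ u : P) (φ : E_M →L[ℝ] E_P) :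
    inCoordinates E_M (B.proj *ᵖ (TangentSpace 𝓘(ℝ, E_M) : M → Type _)) E_P
      (TangentSpace 𝓘(ℝ, E_P) : P → Type _) u₀ u u₀ u φ =
    inCoordinates E_M (TangentSpace 𝓘(ℝ, E_M) : M → Type _) E_P
      (TangentSpace 𝓘(ℝ, E_P) : P → Type _) (B.proj u₀) (B.proj u) u₀ u φ := by
  have key : ∀ v : E_M, (trivializationAt E_M
      (B.proj *ᵖ (TangentSpace 𝓘(ℝ, E_M) : M → Type _)) u₀).symmL ℝ u v =
      (trivializationAt E_M (TangentSpace 𝓘(ℝ, E_M) : M → Type _) (B.proj u₀)).symmL ℝ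
        (B.proj u) v := by
    intro v
    by_cases hu : B.proj u ∈
        (trivializationAt E_M (TangentSpace 𝓘(ℝ, E_M) : M → Type _) (B.proj u₀)).baseSet
    · have hu' : u ∈ (trivializationAt E_M
        (B.proj *ᵖ (TangentSpace 𝓘(ℝ, E_M) : M → Type _)) u₀).baseSet := hu
      rw [Trivialization.symmL_apply _ hu', Trivialization.symmL_apply _ hu,
        Trivialization.symm_apply _ hu']
      rfl
    · have hu' : u ∉ (trivializationAt E_M
        (B.proj *ᵖ (TangentSpace 𝓘(ℝ, E_M) : M → Type _)) u₀).baseSet := hu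
      rw [Trivialization.symmL_apply_of_notMem _ hu', Trivialization.symmL_apply_of_notMem _ hu]
      rfl
  ext v
  simp only [inCoordinates, ContinuousLinearMap.comp_apply]
  congr 1
  exact congrArg φ (key v)

/-- A map to the Hom-bundle is smooth if its base map is and its value is smooth in tangent
coordinates. -/
theorem contMDiffAt_homBundle_iff (f : Z → B.HomBundle) (z₀ : Z) :
    ContMDiffAt I_Z (𝓘(ℝ, E_P).prod 𝓘(ℝ, E_M →L[ℝ] E_P)) ∞ f z₀ ↔
      ContMDiffAt I_Z 𝓘(ℝ, E_P) ∞ (fun z => (f z).1) z₀ ∧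
      ContMDiffAt I_Z 𝓘(ℝ, E_M →L[ℝ] E_P) ∞
        (inTangentCoordinates 𝓘(ℝ, E_M) 𝓘(ℝ, E_P) (fun z => B.proj (f z).1) (fun z => (f z).1)
          (fun z => (f z).2) z₀) z₀ := by
  refine (contMDiffAt_hom_bundle f).trans (and_congr_right fun _ => ?_)
  have : (fun z => inCoordinates E_M (B.proj *ᵖ (TangentSpace 𝓘(ℝ, E_M) : M → Type _)) E_P
      (TangentSpace 𝓘(ℝ, E_P) : P → Type _) (f z₀).1 (f z).1 (f z₀).1 (f z).1 (f z).2) =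
      inTangentCoordinates 𝓘(ℝ, E_M) 𝓘(ℝ, E_P) (fun z => B.proj (f z).1) (fun z => (f z).1)
          (fun z => (f z).2) z₀ := funext fun z => B.inCoordinates_pullback _ _ _
  rw [this]

end PrincipalBundle

end

noncomputable section

section TangentCoordinates

variable {E E' E_Z H H' H_Z M M' Z : Type*}
  [NormedAddCommGroup E] [NormedSpace ℝ E] [TopologicalSpace H]
  [NormedAddCommGroup E'] [NormedSpace ℝ E'] [TopologicalSpace H']
  [NormedAddCommGroup E_Z] [NormedSpace ℝ E_Z] [TopologicalSpace H_Z]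
  {I : ModelWithCorners ℝ E H} {I' : ModelWithCorners ℝ E' H'}
  {I_Z : ModelWithCorners ℝ E_Z H_Z}
  [TopologicalSpace M] [ChartedSpace H M] [IsManifold I 1 M]
  [TopologicalSpace M'] [ChartedSpace H' M'] [IsManifold I' 1 M']
  [TopologicalSpace Z] [ChartedSpace H_Z Z] {n : WithTop ℕ∞}

/-- The chain rule yields base maps such as `c.symm ∘ c ∘ τ`, which agree with the desired `τ` only
near the point. -/
theorem ContMDiffAt.inTangentCoordinates_congr_right {a : Z → M} {b b' : Z → M'}
    {φ : Z → E →L[ℝ] E'} {z₀ : Z}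
    (h : ContMDiffAt I_Z 𝓘(ℝ, E →L[ℝ] E') n (inTangentCoordinates I I' a b φ z₀) z₀)
    (hb : b =ᶠ[𝓝 z₀] b') :
    ContMDiffAt I_Z 𝓘(ℝ, E →L[ℝ] E') n (inTangentCoordinates I I' a b' φ z₀) z₀ := by
  refine h.congr_of_eventuallyEq ?_
  have h0 : b z₀ = b' z₀ := hb.self_of_nhds
  filter_upwards [hb] with z hz
  unfold inTangentCoordinates
  rw [h0, hz]

end TangentCoordinates

namespace PrincipalBundle

open Bundle ContinuousLinearMap Set Function

variable {E_M E_G E_P M G P : Type*}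
  [NormedAddCommGroup E_M] [NormedSpace ℝ E_M] [NormedAddCommGroup E_G] [NormedSpace ℝ E_G]
  [NormedAddCommGroup E_P] [NormedSpace ℝ E_P]
  [TopologicalSpace M] [ChartedSpace E_M M] [IsManifold 𝓘(ℝ, E_M) ∞ M]
  [TopologicalSpace G] [ChartedSpace E_G G] [Group G]
  [TopologicalSpace P] [ChartedSpace E_P P] [IsManifold 𝓘(ℝ, E_P) ∞ P] [MulAction Gᵐᵒᵖ P]
  (B : PrincipalBundle E_M E_G E_P M G P)

variable {E_Z H_Z Z : Type*} [NormedAddCommGroup E_Z] [NormedSpace ℝ E_Z] [TopologicalSpace H_Z]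
  {I_Z : ModelWithCorners ℝ E_Z H_Z} [TopologicalSpace Z] [ChartedSpace H_Z Z]
  {V : Type*} [NormedAddCommGroup V] [NormedSpace ℝ V]

/-- The chart of `Hom(τ^*TM, TP)` induced by a chart `Q` of `P` and a chart `c` of `M`. -/
def homChart (Q : PartialDiffeomorph 𝓘(ℝ, E_P) 𝓘(ℝ, V) P V ∞)
    (c : PartialDiffeomorph 𝓘(ℝ, E_M) 𝓘(ℝ, E_M) M E_M ∞)
    (hQc : ∀ p ∈ Q.source, B.proj p ∈ c.source) :
    PartialDiffeomorph (𝓘(ℝ, E_P).prod 𝓘(ℝ, E_M →L[ℝ] E_P)) 𝓘(ℝ, V × (E_M →L[ℝ] V))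
      B.HomBundle (V × (E_M →L[ℝ] V)) ∞ where
  toFun η := (Q η.1, (mfderiv 𝓘(ℝ, E_P) 𝓘(ℝ, V) Q η.1 : E_P →L[ℝ] V).comp
    ((η.2 : E_M →L[ℝ] E_P).comp
      (mfderiv 𝓘(ℝ, E_M) 𝓘(ℝ, E_M) c.symm (c (B.proj η.1)) : E_M →L[ℝ] E_M)))
  invFun y := ⟨Q.symm y.1, ((mfderiv 𝓘(ℝ, V) 𝓘(ℝ, E_P) Q.symm y.1 : V →L[ℝ] E_P).comp
    (y.2.comp (mfderiv 𝓘(ℝ, E_M) 𝓘(ℝ, E_M) c (B.proj (Q.symm y.1)) : E_M →L[ℝ] E_M)) :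
      E_M →L[ℝ] E_P)⟩
  source := {η | η.1 ∈ Q.source}
  target := {y | y.1 ∈ Q.target}
  map_source' η hη := Q.map_source hη
  map_target' y hy := Q.map_target hy
  left_inv' := by
    rintro ⟨p, φ⟩ hp
    have hp' : p ∈ Q.source := hp
    have h1 : Q.symm (Q p) = p := Q.left_inv hp'
    have h2 := Q.mfderiv_symm_comp_mfderiv (by simp) hp'
    have h3 := c.mfderiv_symm_comp_mfderiv (by simp) (hQc p hp')
    apply TotalSpace.ext h1
    apply heq_of_eq
    show (_ : E_M →L[ℝ] E_P) = φ
    dsimp only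
    rw [h1]
    ext v
    have h2' := congrArg (fun L : E_P →L[ℝ] E_P => L ((φ : E_M →L[ℝ] E_P) v)) h2
    have h3' := congrArg (fun L : E_M →L[ℝ] E_M => L v) h3
    simp only [ContinuousLinearMap.id_apply] at h2' h3' ⊢
    exact (congrArg (fun w => (mfderiv 𝓘(ℝ, V) 𝓘(ℝ, E_P) Q.symm (Q p) : V →L[ℝ] E_P)
      ((mfderiv 𝓘(ℝ, E_P) 𝓘(ℝ, V) Q p : E_P →L[ℝ] V) ((φ : E_M →L[ℝ] E_P) w))) h3').trans h2'
  right_inv' := by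
    rintro ⟨y, A⟩ hy
    have hy' : y ∈ Q.target := hy
    have h1 : Q (Q.symm y) = y := Q.right_inv hy'
    have h2 := Q.mfderiv_comp_mfderiv_symm (by simp) hy'
    have h3 := c.mfderiv_comp_mfderiv_symm' (by simp) (hQc _ (Q.map_target hy'))
    refine Prod.ext h1 ?_
    ext v : 1
    have h3' := congrArg (fun L : E_M →L[ℝ] E_M => A (L v)) h3
    have h2' := congrArg (fun L : V →L[ℝ] V => L (A v)) h2
    simp only [ContinuousLinearMap.id_apply] at h2' h3' ⊢
    exact (congrArg (fun w => (mfderiv 𝓘(ℝ, E_P) 𝓘(ℝ, V) Q (Q.symm y) : E_P →L[ℝ] V)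
      ((mfderiv 𝓘(ℝ, V) 𝓘(ℝ, E_P) Q.symm y : V →L[ℝ] E_P) w)) h3').trans h2'
  open_source := Q.open_source.preimage (FiberBundle.continuous_proj _ _)
  open_target := Q.open_target.preimage continuous_fst
  contMDiffOn_toFun := by
    intro η hη
    have hp : η.1 ∈ Q.source := hη
    have hπ : ContMDiffAt (𝓘(ℝ, E_P).prod 𝓘(ℝ, E_M →L[ℝ] E_P)) 𝓘(ℝ, E_P) ∞
        (fun η : B.HomBundle => η.1) η := contMDiffAt_proj _
    have hid := ((B.contMDiffAt_homBundle_iff id η).1 contMDiffAt_id).2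
    have hτ : ContMDiffAt (𝓘(ℝ, E_P).prod 𝓘(ℝ, E_M →L[ℝ] E_P)) 𝓘(ℝ, E_M) ∞
        (fun η : B.HomBundle => B.proj η.1) η := B.proj.contMDiff.contMDiffAt.comp η hπ
    have hcτ : ContMDiffAt (𝓘(ℝ, E_P).prod 𝓘(ℝ, E_M →L[ℝ] E_P)) 𝓘(ℝ, E_M) ∞
        (fun η : B.HomBundle => c (B.proj η.1)) η :=
      (c.contMDiffAt (hQc _ hp)).comp η hτ
    have hQ := (Q.contMDiffAt hp).inTangentCoordinates_mfderiv hπ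
    have hc := (ContMDiffAt.inTangentCoordinates_mfderiv
      (a := fun η : B.HomBundle => c (B.proj η.1)) (z₀ := η)
      (c.contMDiffAt_symm (c.map_source (hQc _ hp)))
      hcτ).inTangentCoordinates_congr_right (b' := fun η : B.HomBundle => B.proj η.1) (by
        have : ∀ᶠ η' in 𝓝 η, (η' : B.HomBundle).1 ∈ Q.source :=
          hπ.continuousAt.eventually_mem (Q.open_source.mem_nhds hp)
        filter_upwards [this] with η' hη'
        exact c.left_inv (hQc _ hη'))
    have h := ContMDiffAt.inTangentCoordinates_comp hπ.continuousAt hQ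
      (ContMDiffAt.inTangentCoordinates_comp hτ.continuousAt hid hc)
    -- The outer base maps now take values in vector spaces, where tangent coordinates are the
    -- family itself.
    rw [inTangentCoordinates_model_space] at h
    exact (((Q.contMDiffAt hp).comp η hπ).prodMk_space h).contMDiffWithinAt
  contMDiffOn_invFun := by
    intro y hy
    have hy' : y.1 ∈ Q.target := hy
    apply ContMDiffAt.contMDiffWithinAt
    have hfst : ContMDiffAt 𝓘(ℝ, V × (E_M →L[ℝ] V)) 𝓘(ℝ, V) ∞
        (fun y : V × (E_M →L[ℝ] V) => y.1) y := ContDiff.contMDiff (by fun_prop) y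
    have hsnd : ContMDiffAt 𝓘(ℝ, V × (E_M →L[ℝ] V)) 𝓘(ℝ, E_M →L[ℝ] V) ∞
        (fun y : V × (E_M →L[ℝ] V) => y.2) y := ContDiff.contMDiff (by fun_prop) y
    have hbase : ContMDiffAt 𝓘(ℝ, V × (E_M →L[ℝ] V)) 𝓘(ℝ, E_P) ∞
        (fun y : V × (E_M →L[ℝ] V) => Q.symm y.1) y := (Q.contMDiffAt_symm hy').comp y hfst
    have hτ : ContMDiffAt 𝓘(ℝ, V × (E_M →L[ℝ] V)) 𝓘(ℝ, E_M) ∞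
        (fun y : V × (E_M →L[ℝ] V) => B.proj (Q.symm y.1)) y :=
      B.proj.contMDiff.contMDiffAt.comp y hbase
    have hmem : B.proj (Q.symm y.1) ∈ c.source := hQc _ (Q.map_target hy')
    have hcτ : ContMDiffAt 𝓘(ℝ, V × (E_M →L[ℝ] V)) 𝓘(ℝ, E_M) ∞
        (fun y : V × (E_M →L[ℝ] V) => c (B.proj (Q.symm y.1))) y := (c.contMDiffAt hmem).comp y hτ
    refine (B.contMDiffAt_homBundle_iff _ y).2 ⟨hbase, ?_⟩
    have hQ := (Q.contMDiffAt_symm hy').inTangentCoordinates_mfderiv hfst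
    have hc := ContMDiffAt.inTangentCoordinates_mfderiv
      (a := fun y : V × (E_M →L[ℝ] V) => B.proj (Q.symm y.1)) (z₀ := y) (c.contMDiffAt hmem) hτ
    have hA : ContMDiffAt 𝓘(ℝ, V × (E_M →L[ℝ] V)) 𝓘(ℝ, E_M →L[ℝ] V) ∞
        (inTangentCoordinates 𝓘(ℝ, E_M) 𝓘(ℝ, V)
          (fun y : V × (E_M →L[ℝ] V) => c (B.proj (Q.symm y.1)))
          (fun y => y.1) (fun y => y.2) y) y := by
      rw [inTangentCoordinates_model_space]; exact hsnd
    exact ContMDiffAt.inTangentCoordinates_comp hfst.continuousAt hQ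
      (ContMDiffAt.inTangentCoordinates_comp hcτ.continuousAt hA hc)

/-- In the chart of the Hom-bundle, `J¹P` is the set of `A` whose first component is the identity,
provided `Q` is adapted to the projection. -/
theorem fst_comp_homChart_eq_id_iff
    (Q : PartialDiffeomorph 𝓘(ℝ, E_P) 𝓘(ℝ, E_M × E_G) P (E_M × E_G) ∞)
    (c : PartialDiffeomorph 𝓘(ℝ, E_M) 𝓘(ℝ, E_M) M E_M ∞)
    (hQc : ∀ p ∈ Q.source, B.proj p ∈ c.source) (hQ : ∀ p ∈ Q.source, (Q p).1 = c (B.proj p))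
    {η : B.HomBundle} (hη : η.1 ∈ Q.source) :
    (ContinuousLinearMap.fst ℝ E_M E_G).comp (B.homChart Q c hQc η).2 =
        ContinuousLinearMap.id ℝ E_M ↔
      ∀ v : TangentSpace 𝓘(ℝ, E_M) (B.proj η.1), B.tangentProj η.1 (η.2 v) = v := by
  have hτ := B.proj.contMDiff.mdifferentiable (by simp) η.1
  have hc := (c.contMDiffAt (hQc _ hη)).mdifferentiableAt (by simp)
  have hQd := (Q.contMDiffAt hη).mdifferentiableAt (by simp)
  have hfst : MDifferentiableAt 𝓘(ℝ, E_M × E_G) 𝓘(ℝ, E_M)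
      (ContinuousLinearMap.fst ℝ E_M E_G) (Q η.1) :=
    (ContinuousLinearMap.fst ℝ E_M E_G).mdifferentiableAt
  have h1 := mfderiv_comp η.1 hfst hQd
  have h2 := mfderiv_comp η.1 hc hτ
  have h3 : (ContinuousLinearMap.fst ℝ E_M E_G) ∘ Q =ᶠ[𝓝 η.1] c ∘ B.proj :=
    Filter.eventually_of_mem (Q.open_source.mem_nhds hη) fun p hp => hQ p hp
  have h4 : (mfderiv 𝓘(ℝ, E_P) 𝓘(ℝ, E_M) ((ContinuousLinearMap.fst ℝ E_M E_G) ∘ Q) η.1 :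
      E_P →L[ℝ] E_M) = mfderiv 𝓘(ℝ, E_P) 𝓘(ℝ, E_M) (c ∘ B.proj) η.1 := h3.mfderiv_eq
  have h5 : (mfderiv 𝓘(ℝ, E_M × E_G) 𝓘(ℝ, E_M) (ContinuousLinearMap.fst ℝ E_M E_G) (Q η.1) :
      E_M × E_G →L[ℝ] E_M) = ContinuousLinearMap.fst ℝ E_M E_G :=
    (ContinuousLinearMap.fst ℝ E_M E_G).mfderiv_eq
  let dτ : E_P →L[ℝ] E_M := mfderiv 𝓘(ℝ, E_P) 𝓘(ℝ, E_M) B.proj η.1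
  let dQ : E_P →L[ℝ] E_M × E_G := mfderiv 𝓘(ℝ, E_P) 𝓘(ℝ, E_M × E_G) Q η.1
  let dc : E_M →L[ℝ] E_M := mfderiv 𝓘(ℝ, E_M) 𝓘(ℝ, E_M) c (B.proj η.1)
  let dc' : E_M →L[ℝ] E_M := mfderiv 𝓘(ℝ, E_M) 𝓘(ℝ, E_M) c.symm (c (B.proj η.1))
  let φ : E_M →L[ℝ] E_P := η.2
  -- Differentiating `fst ∘ Q = c ∘ τ` shows that the coordinate condition is the conjugate by `Tc`
  -- of `Tτ ∘ φ = id`.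
  have hcomp : ∀ w : E_P, (dQ w).1 = dc (dτ w) := by
    have h6 : (ContinuousLinearMap.fst ℝ E_M E_G).comp dQ = dc.comp dτ := by
      rw [← h5]
      exact h1.symm.trans (h4.trans h2)
    exact fun w => congrArg (fun L : E_P →L[ℝ] E_M => L w) h6
  have hl : ∀ v, dc' (dc v) = v := fun v => congrArg (fun L : E_M →L[ℝ] E_M => L v)
    (c.mfderiv_symm_comp_mfderiv (by simp) (hQc _ hη))
  have hr : ∀ v, dc (dc' v) = v := fun v => congrArg (fun L : E_M →L[ℝ] E_M => L v)
    (c.mfderiv_comp_mfderiv_symm' (by simp) (hQc _ hη))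
  show (ContinuousLinearMap.fst ℝ E_M E_G).comp (dQ.comp (φ.comp dc')) =
    ContinuousLinearMap.id ℝ E_M ↔ ∀ v : E_M, dτ (φ v) = v
  constructor
  · intro h v
    have h' : (dQ (φ (dc' (dc v)))).1 = dc v :=
      congrArg (fun L : E_M →L[ℝ] E_M => L (dc v)) h
    rw [hl, hcomp] at h'
    rw [← hl (dτ (φ v)), h', hl]
  · intro h
    ext v
    show (dQ (φ (dc' v))).1 = v
    rw [hcomp, h, hr]

end PrincipalBundle

end

noncomputable section

section Charts

open Set Function

variable {E E' F F' H H' M N M' N' : Type*}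
  [NormedAddCommGroup E] [NormedSpace ℝ E] [NormedAddCommGroup E'] [NormedSpace ℝ E']
  [NormedAddCommGroup F] [NormedSpace ℝ F] [NormedAddCommGroup F'] [NormedSpace ℝ F']
  [TopologicalSpace M] [TopologicalSpace N]

/-- The preferred chart at a point of a manifold modelled on a vector space. -/
def chartDiffeomorph [ChartedSpace E M] (n : WithTop ℕ∞) [IsManifold 𝓘(ℝ, E) n M] (x : M) :
    PartialDiffeomorph 𝓘(ℝ, E) 𝓘(ℝ, E) M E n where
  toPartialEquiv := (chartAt E x).toPartialEquiv
  open_source := (chartAt E x).open_source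
  open_target := (chartAt E x).open_target
  contMDiffOn_toFun := contMDiffOn_chart
  contMDiffOn_invFun := contMDiffOn_chart_symm

theorem mem_chartDiffeomorph_source [ChartedSpace E M] (n : WithTop ℕ∞)
    [IsManifold 𝓘(ℝ, E) n M] (x : M) : x ∈ (chartDiffeomorph (E := E) n x).source :=
  mem_chart_source E x

/-- The product of two charts with values in vector spaces. -/
def PartialDiffeomorph.prodSpace [TopologicalSpace H] [TopologicalSpace H']
    {I : ModelWithCorners ℝ E H} {J : ModelWithCorners ℝ E' H'}
    [ChartedSpace H M] [ChartedSpace H' N] {n : WithTop ℕ∞}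
    (c : PartialDiffeomorph I 𝓘(ℝ, F) M F n) (k : PartialDiffeomorph J 𝓘(ℝ, F') N F' n) :
    PartialDiffeomorph (I.prod J) 𝓘(ℝ, F × F') (M × N) (F × F') n where
  toPartialEquiv := c.toPartialEquiv.prod k.toPartialEquiv
  open_source := c.open_source.prod k.open_source
  open_target := c.open_target.prod k.open_target
  contMDiffOn_toFun := ContMDiffOn.prodMk_space
    (c.contMDiffOn.comp contMDiffOn_fst fun _ hp => hp.1)
    (k.contMDiffOn.comp contMDiffOn_snd fun _ hp => hp.2)
  contMDiffOn_invFun := ContMDiffOn.prodMk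
    (c.symm.contMDiffOn.comp
      (ContDiff.contMDiff (f := fun p : F × F' => p.1) (by fun_prop)).contMDiffOn
      fun _ hp => hp.1)
    (k.symm.contMDiffOn.comp
      (ContDiff.contMDiff (f := fun p : F × F' => p.2) (by fun_prop)).contMDiffOn
      fun _ hp => hp.2)

end Charts

/-! ### Separation and countability of total spaces -/

section TotalSpaceTopology

open Bundle Set

variable {X F : Type*} [TopologicalSpace X] [TopologicalSpace F] (E : X → Type*)
  [TopologicalSpace (TotalSpace F E)] [∀ x, TopologicalSpace (E x)] [FiberBundle F E]

/-- Points of different fibres are separated by the projection. Points of one fibre lie in a common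
trivialization, where they are separated in `X × F`. -/
theorem FiberBundle.t2Space_totalSpace [T2Space X] [T2Space F] : T2Space (TotalSpace F E) := by
  refine ⟨fun p q hpq => ?_⟩
  by_cases h : p.1 = q.1
  · let e := trivializationAt F E p.1
    have hp : p ∈ e.source := by
      rw [e.mem_source]; exact mem_baseSet_trivializationAt F E p.1
    have hq : q ∈ e.source := by
      rw [e.mem_source, ← h]; exact mem_baseSet_trivializationAt F E p.1
    have hne : e p ≠ e q := fun he => hpq (e.injOn hp hq he)
    obtain ⟨u, v, hu, hv, hpu, hqv, huv⟩ := t2_separation hne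
    refine ⟨e.source ∩ e ⁻¹' u, e.source ∩ e ⁻¹' v,
      e.toOpenPartialHomeomorph.isOpen_inter_preimage hu,
      e.toOpenPartialHomeomorph.isOpen_inter_preimage hv, ⟨hp, hpu⟩, ⟨hq, hqv⟩, ?_⟩
    exact (huv.preimage e).mono inter_subset_right inter_subset_right
  · exact separated_by_continuous (FiberBundle.continuous_proj F E) h

/-- By the Lindelöf property, countably many trivializations cover, and each domain is homeomorphic
to a subspace of `X × F`. -/
theorem FiberBundle.secondCountableTopology_totalSpace [SecondCountableTopology X]
    [SecondCountableTopology F] : SecondCountableTopology (TotalSpace F E) := by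
  obtain ⟨s, hs, hsU⟩ := TopologicalSpace.countable_cover_nhds
    (f := fun x : X => (trivializationAt F E x).baseSet)
    fun x => (trivializationAt F E x).open_baseSet.mem_nhds (mem_baseSet_trivializationAt F E x)
  have := hs.to_subtype
  have hsc : ∀ x : s, SecondCountableTopology (trivializationAt F E (x : X)).source := fun x =>
    let e := trivializationAt F E (x : X)
    e.toOpenPartialHomeomorph.toHomeomorphSourceTarget.secondCountableTopology
  refine TopologicalSpace.secondCountableTopology_of_countable_cover
    (U := fun x : s => (trivializationAt F E (x : X)).source)
    (fun x => (trivializationAt F E (x : X)).open_source) ?_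
  refine eq_univ_of_forall fun p => ?_
  have hp : p.1 ∈ ⋃ x ∈ s, (trivializationAt F E x).baseSet := hsU ▸ mem_univ _
  obtain ⟨x, hx, hpx⟩ := mem_iUnion₂.1 hp
  exact mem_iUnion.2 ⟨⟨x, hx⟩, (trivializationAt F E x).mem_source.2 hpx⟩

end TotalSpaceTopology

/-! ### `J¹P` as an embedded submanifold -/

namespace PrincipalBundle

open Bundle ContinuousLinearMap Set Function Topology

variable {E_M E_G E_P M G P : Type*}
  [NormedAddCommGroup E_M] [NormedSpace ℝ E_M] [NormedAddCommGroup E_G] [NormedSpace ℝ E_G]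
  [NormedAddCommGroup E_P] [NormedSpace ℝ E_P]
  [TopologicalSpace M] [ChartedSpace E_M M]
  [TopologicalSpace G] [ChartedSpace E_G G] [Group G]
  [TopologicalSpace P] [ChartedSpace E_P P] [MulAction Gᵐᵒᵖ P]
  (B : PrincipalBundle E_M E_G E_P M G P)

/-- `φ` is an equivariant local trivialization of `P` over `U`. -/
structure IsTrivialization (U : Set M)
    (φ : PartialDiffeomorph 𝓘(ℝ, E_P) (𝓘(ℝ, E_M).prod 𝓘(ℝ, E_G)) P (M × G) ∞) : Prop where
  isOpen : IsOpen U
  source_eq : φ.source = B.proj ⁻¹' U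
  target_eq : φ.target = U ×ˢ Set.univ
  fst_eq : ∀ p ∈ φ.source, (φ p).1 = B.proj p
  snd_act : ∀ p ∈ φ.source, ∀ g : G, (φ (p <• g)).2 = (φ p).2 * g

theorem exists_isTrivialization (x : M) : ∃ U φ, x ∈ U ∧ B.IsTrivialization U φ := by
  obtain ⟨U, φ, h1, h2, h3, h4, h5, h6⟩ := B.isPrincipalBundle.exists_trivialization x
  exact ⟨U, φ, h2, h1, h3, h4, h5, h6⟩

variable {B} in
theorem IsTrivialization.mem_source {U : Set M}
    {φ : PartialDiffeomorph 𝓘(ℝ, E_P) (𝓘(ℝ, E_M).prod 𝓘(ℝ, E_G)) P (M × G) ∞}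
    (hφ : B.IsTrivialization U φ) {p : P} : p ∈ φ.source ↔ B.proj p ∈ U := by
  rw [hφ.source_eq]; rfl

variable {B} in
theorem IsTrivialization.mem_target {U : Set M}
    {φ : PartialDiffeomorph 𝓘(ℝ, E_P) (𝓘(ℝ, E_M).prod 𝓘(ℝ, E_G)) P (M × G) ∞}
    (hφ : B.IsTrivialization U φ) {x : M} {g : G} : (x, g) ∈ φ.target ↔ x ∈ U := by
  rw [hφ.target_eq]; simp

variable {B} in
theorem IsTrivialization.proj_symm {U : Set M}
    {φ : PartialDiffeomorph 𝓘(ℝ, E_P) (𝓘(ℝ, E_M).prod 𝓘(ℝ, E_G)) P (M × G) ∞}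
    (hφ : B.IsTrivialization U φ) {x : M} {g : G} (hx : x ∈ U) :
    B.proj (φ.symm (x, g)) = x := by
  have h := hφ.mem_target (g := g).2 hx
  refine (hφ.fst_eq _ (φ.map_target h)).symm.trans ?_
  exact congrArg Prod.fst (φ.right_inv h)

/-- The charts `Q` of `P` and `c` of `M` are adapted: the projection is `Prod.fst` in them. -/
structure IsAdapted (Q : PartialDiffeomorph 𝓘(ℝ, E_P) 𝓘(ℝ, E_M × E_G) P (E_M × E_G) ∞)
    (c : PartialDiffeomorph 𝓘(ℝ, E_M) 𝓘(ℝ, E_M) M E_M ∞) : Prop where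
  proj_mem : ∀ p ∈ Q.source, B.proj p ∈ c.source
  fst_eq : ∀ p ∈ Q.source, (Q p).1 = c (B.proj p)

variable {B} in
theorem IsTrivialization.isAdapted {U : Set M}
    {φ : PartialDiffeomorph 𝓘(ℝ, E_P) (𝓘(ℝ, E_M).prod 𝓘(ℝ, E_G)) P (M × G) ∞}
    (hφ : B.IsTrivialization U φ) (c : PartialDiffeomorph 𝓘(ℝ, E_M) 𝓘(ℝ, E_M) M E_M ∞)
    (k : PartialDiffeomorph 𝓘(ℝ, E_G) 𝓘(ℝ, E_G) G E_G ∞) :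
    B.IsAdapted (φ.trans (c.prodSpace k)) c where
  proj_mem p hp := by
    rw [← hφ.fst_eq p hp.1]
    exact hp.2.1
  fst_eq p hp := congrArg c (hφ.fst_eq p hp.1)

theorem exists_isAdapted [IsManifold 𝓘(ℝ, E_M) ∞ M] [IsManifold 𝓘(ℝ, E_G) ∞ G] (p : P) :
    ∃ Q, p ∈ Q.source ∧ B.IsAdapted Q (chartDiffeomorph (E := E_M) ∞ (B.proj p)) := by
  obtain ⟨U, φ, hU, hφ⟩ := B.exists_isTrivialization (B.proj p)
  have hp : p ∈ φ.source := hφ.mem_source.2 hU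
  refine ⟨φ.trans ((chartDiffeomorph (E := E_M) ∞ (B.proj p)).prodSpace
    (chartDiffeomorph (E := E_G) ∞ (φ p).2)), ?_, hφ.isAdapted _ _⟩
  refine ⟨hp, ?_, mem_chartDiffeomorph_source ∞ _⟩
  have h : (φ p).1 ∈ (chartDiffeomorph (E := E_M) ∞ (B.proj p)).source := by
    rw [hφ.fst_eq p hp]; exact mem_chartDiffeomorph_source ∞ _
  exact h

variable [IsManifold 𝓘(ℝ, E_M) ∞ M] [IsManifold 𝓘(ℝ, E_P) ∞ P]

/-- Separates the coordinates `(x, g, A)` of a jet from the coordinates transverse to `J¹P`. -/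
def jetSplitting (E_M E_G : Type*) [NormedAddCommGroup E_M] [NormedSpace ℝ E_M]
    [NormedAddCommGroup E_G] [NormedSpace ℝ E_G] :
    PartialDiffeomorph 𝓘(ℝ, (E_M × E_G) × (E_M →L[ℝ] E_M × E_G))
      𝓘(ℝ, ModelJ1 E_M E_G × (E_M →L[ℝ] E_M))
      ((E_M × E_G) × (E_M →L[ℝ] E_M × E_G)) (ModelJ1 E_M E_G × (E_M →L[ℝ] E_M)) ∞ where
  -- Subtracting the identity turns the affine jet condition into the vanishing of the last
  -- coordinate.
  toFun y := ((y.1.1, y.1.2, (ContinuousLinearMap.snd ℝ E_M E_G).comp y.2),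
    (ContinuousLinearMap.fst ℝ E_M E_G).comp y.2 - ContinuousLinearMap.id ℝ E_M)
  invFun a := ((a.1.1, a.1.2.1), (ContinuousLinearMap.inl ℝ E_M E_G).comp
    (a.2 + ContinuousLinearMap.id ℝ E_M) + (ContinuousLinearMap.inr ℝ E_M E_G).comp a.1.2.2)
  source := univ
  target := univ
  map_source' _ _ := mem_univ _
  map_target' _ _ := mem_univ _
  left_inv' := by
    rintro ⟨⟨x, g⟩, A⟩ -
    refine Prod.ext rfl ?_
    ext v <;> simp
  right_inv' := by
    rintro ⟨⟨x, g, A⟩, D⟩ -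
    refine Prod.ext (Prod.ext rfl (Prod.ext rfl ?_)) ?_ <;> ext v <;> simp
  open_source := isOpen_univ
  open_target := isOpen_univ
  contMDiffOn_toFun := (ContDiff.contMDiff (by fun_prop)).contMDiffOn
  contMDiffOn_invFun := (ContDiff.contMDiff (by fun_prop)).contMDiffOn

theorem isEmbedding_incl : IsEmbedding B.incl := IsEmbedding.subtypeVal

variable {B} in
-- In adapted charts the jet condition is `fst ∘ A = id`, which leaves `snd ∘ A` and the base point
-- free.
theorem IsAdapted.isSlice {Q : PartialDiffeomorph 𝓘(ℝ, E_P) 𝓘(ℝ, E_M × E_G) P (E_M × E_G) ∞}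
    {c : PartialDiffeomorph 𝓘(ℝ, E_M) 𝓘(ℝ, E_M) M E_M ∞} (h : B.IsAdapted Q c) :
    ((B.homChart Q c h.proj_mem).trans (jetSplitting E_M E_G)).IsSlice B.incl where
  snd_eq_zero ρ hρ := by
    have hmem : (B.incl ρ).1 ∈ Q.source := hρ.1
    have h1 := (B.fst_comp_homChart_eq_id_iff Q c h.proj_mem h.fst_eq hmem).2 ρ.2
    exact sub_eq_zero.2 h1
  exists_eq a ha := by
    have ha' := ((B.homChart Q c h.proj_mem).trans (jetSplitting E_M E_G)).map_target ha
    have hr := ((B.homChart Q c h.proj_mem).trans (jetSplitting E_M E_G)).right_inv ha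
    set η := ((B.homChart Q c h.proj_mem).trans (jetSplitting E_M E_G)).symm (a, 0) with hη
    have hmem : η.1 ∈ Q.source := ha'.1
    refine ⟨⟨η, (B.fst_comp_homChart_eq_id_iff Q c h.proj_mem h.fst_eq hmem).1 ?_⟩, rfl⟩
    exact sub_eq_zero.1 (congrArg Prod.snd hr)

theorem exists_isSmoothEmbedding_incl [IsManifold 𝓘(ℝ, E_G) ∞ G] :
    ∃ _ : ChartedSpace (ModelJ1 E_M E_G) B.J1, IsManifold 𝓘(ℝ, ModelJ1 E_M E_G) ∞ B.J1 ∧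
      Manifold.IsSmoothEmbedding 𝓘(ℝ, ModelJ1 E_M E_G)
        (𝓘(ℝ, E_P).prod 𝓘(ℝ, E_M →L[ℝ] E_P)) ∞ B.incl := by
  refine exists_isSmoothEmbedding_of_isSlice (K := E_M →L[ℝ] E_M) (by simp) B.isEmbedding_incl
    fun ρ => ?_
  obtain ⟨Q, hQ, hQc⟩ := B.exists_isAdapted (B.tau10 ρ)
  refine ⟨_, ?_, hQc.isSlice⟩
  exact ⟨hQ, mem_univ _⟩

theorem t2Space_J1 [T2Space P] : T2Space B.J1 := by
  have : T2Space B.HomBundle := FiberBundle.t2Space_totalSpace _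
  exact B.isEmbedding_incl.t2Space

theorem secondCountableTopology_J1 [FiniteDimensional ℝ E_M] [FiniteDimensional ℝ E_P]
    [SecondCountableTopology P] : SecondCountableTopology B.J1 := by
  -- Finite dimension makes the fibre proper, hence second countable.
  have : ProperSpace (E_M →L[ℝ] E_P) := FiniteDimensional.proper ℝ _
  have : SecondCountableTopology B.HomBundle := FiberBundle.secondCountableTopology_totalSpace _
  exact B.isEmbedding_incl.secondCountableTopology

section Action

variable {E_Z H_Z Z : Type*} [NormedAddCommGroup E_Z] [NormedSpace ℝ E_Z] [TopologicalSpace H_Z]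
  {I_Z : ModelWithCorners ℝ E_Z H_Z} [TopologicalSpace Z] [ChartedSpace H_Z Z]

theorem contMDiffAt_tau10_of_incl {ρ : Z → B.J1} {z₀ : Z}
    (hρ : ContMDiffAt I_Z (𝓘(ℝ, E_P).prod 𝓘(ℝ, E_M →L[ℝ] E_P)) ∞ (fun z => B.incl (ρ z)) z₀) :
    ContMDiffAt I_Z 𝓘(ℝ, E_P) ∞ (fun z => B.tau10 (ρ z)) z₀ :=
  ((B.contMDiffAt_homBundle_iff _ z₀).1 hρ).1

/-- The action of `G` on `J¹P` is smooth as a map to the Hom-bundle. -/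
theorem contMDiffAt_incl_act [IsManifold I_Z 1 Z] {ρ : Z → B.J1} {g : Z → G} {z₀ : Z}
    (hρ : ContMDiffAt I_Z (𝓘(ℝ, E_P).prod 𝓘(ℝ, E_M →L[ℝ] E_P)) ∞ (fun z => B.incl (ρ z)) z₀)
    (hg : ContMDiffAt I_Z 𝓘(ℝ, E_G) ∞ g z₀) :
    ContMDiffAt I_Z (𝓘(ℝ, E_P).prod 𝓘(ℝ, E_M →L[ℝ] E_P)) ∞
      (fun z => B.incl (ρ z <• g z)) z₀ := by
  obtain ⟨h1, h2⟩ := (B.contMDiffAt_homBundle_iff _ z₀).1 hρ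
  have hact := B.isPrincipalBundle.contMDiff_act
  refine (B.contMDiffAt_homBundle_iff _ z₀).2 ⟨?_, ?_⟩
  · exact hact.contMDiffAt.comp z₀ (h1.prodMk hg)
  · have hf : ContMDiffAt (I_Z.prod 𝓘(ℝ, E_P)) 𝓘(ℝ, E_P) ∞
        (uncurry fun (z : Z) (p : P) => p <• g z) (z₀, B.tau10 (ρ z₀)) :=
      hact.contMDiffAt.comp (z₀, B.tau10 (ρ z₀)) (contMDiffAt_snd.prodMk
        (ContMDiffAt.comp (z₀, B.tau10 (ρ z₀)) hg contMDiffAt_fst))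
    -- The translation varies with `z`, so smooth dependence of a derivative on parameters is
    -- needed, not just smoothness of each translation.
    have hd := ContMDiffAt.mfderiv (m := ∞) (fun (z : Z) (p : P) => p <• g z)
      (fun z => B.tau10 (ρ z)) hf h1 (by rfl)
    have h := ContMDiffAt.inTangentCoordinates_comp h1.continuousAt hd h2
    have hproj : (fun z => B.proj (B.incl (ρ z <• g z)).1) = fun z => B.proj (B.incl (ρ z)).1 :=
      funext fun z => B.tau1_act (ρ z) (g z)
    rw [hproj]
    exact h

end Action

end PrincipalBundle

end

noncomputable section

theorem act_act {G X : Type*} [Group G] [MulAction Gᵐᵒᵖ X] (x : X) (a b : G) :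
    (x <• a) <• b = x <• (a * b) := by
  rw [MulOpposite.op_mul, mul_smul]

theorem act_one {G X : Type*} [Group G] [MulAction Gᵐᵒᵖ X] (x : X) : x <• (1 : G) = x := by
  rw [MulOpposite.op_one, one_smul]

namespace PrincipalBundle

open Bundle ContinuousLinearMap Set Function Topology Manifold

variable {E_M E_G E_P M G P : Type*}
  [NormedAddCommGroup E_M] [NormedSpace ℝ E_M] [NormedAddCommGroup E_G] [NormedSpace ℝ E_G]
  [NormedAddCommGroup E_P] [NormedSpace ℝ E_P]
  [TopologicalSpace M] [ChartedSpace E_M M] [IsManifold 𝓘(ℝ, E_M) ∞ M]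
  [TopologicalSpace G] [ChartedSpace E_G G] [Group G]
  [TopologicalSpace P] [ChartedSpace E_P P] [IsManifold 𝓘(ℝ, E_P) ∞ P] [MulAction Gᵐᵒᵖ P]
  {B : PrincipalBundle E_M E_G E_P M G P}

/-! ### Normalized jets and local triviality of the action on `J¹P` -/

section Normalization

/-- The `G`-component of a jet in a trivialization. -/
def gauge (φ : PartialDiffeomorph 𝓘(ℝ, E_P) (𝓘(ℝ, E_M).prod 𝓘(ℝ, E_G)) P (M × G) ∞)
    (ρ : B.J1) : G := (φ (B.tau10 ρ)).2

/-- The representative with trivial `G`-component in the orbit of a jet. -/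
def normalize (φ : PartialDiffeomorph 𝓘(ℝ, E_P) (𝓘(ℝ, E_M).prod 𝓘(ℝ, E_G)) P (M × G) ∞)
    (ρ : B.J1) : B.J1 := ρ <• (gauge φ ρ)⁻¹

variable {U : Set M} {φ : PartialDiffeomorph 𝓘(ℝ, E_P) (𝓘(ℝ, E_M).prod 𝓘(ℝ, E_G)) P (M × G) ∞}

omit [IsManifold 𝓘(ℝ, E_M) ∞ M] [IsManifold 𝓘(ℝ, E_P) ∞ P] in
theorem IsTrivialization.tau10_mem (hφ : B.IsTrivialization U φ) {ρ : B.J1} (hρ : B.tau1 ρ ∈ U) :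
    B.tau10 ρ ∈ φ.source := hφ.mem_source.2 hρ

theorem IsTrivialization.gauge_act (hφ : B.IsTrivialization U φ) {ρ : B.J1} (hρ : B.tau1 ρ ∈ U)
    (g : G) : gauge φ (ρ <• g) = gauge φ ρ * g := hφ.snd_act _ (hφ.tau10_mem hρ) g

theorem normalize_act_gauge (ρ : B.J1) : normalize φ ρ <• gauge φ ρ = ρ := by
  rw [normalize, act_act, inv_mul_cancel, act_one]

/-- The factor `g` gained by the jet cancels against the one gained by its `G`-component. So
`normalize` is constant on orbits and descends to `J¹P/G`. -/
theorem IsTrivialization.normalize_act (hφ : B.IsTrivialization U φ) {ρ : B.J1}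
    (hρ : B.tau1 ρ ∈ U) (g : G) : normalize φ (ρ <• g) = normalize φ ρ := by
  rw [normalize, hφ.gauge_act hρ, act_act, normalize]
  simp

theorem tau1_normalize (ρ : B.J1) : B.tau1 (normalize φ ρ) = B.tau1 ρ := B.tau1_act _ _

theorem IsTrivialization.gauge_normalize (hφ : B.IsTrivialization U φ) {ρ : B.J1}
    (hρ : B.tau1 ρ ∈ U) : gauge φ (normalize φ ρ) = 1 := by
  rw [normalize, hφ.gauge_act hρ, mul_inv_cancel]

theorem normalize_eq_self {ρ : B.J1} (h : gauge φ ρ = 1) : normalize φ ρ = ρ := by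
  rw [normalize, h, inv_one, act_one]

omit [IsManifold 𝓘(ℝ, E_M) ∞ M] [IsManifold 𝓘(ℝ, E_P) ∞ P] in
theorem IsTrivialization.apply_tau10 (hφ : B.IsTrivialization U φ) {ρ : B.J1}
    (hρ : B.tau1 ρ ∈ U) : φ (B.tau10 ρ) = (B.tau1 ρ, gauge φ ρ) :=
  Prod.ext (hφ.fst_eq _ (hφ.tau10_mem hρ)) rfl

end Normalization

section JetStructure

variable [ChartedSpace (ModelJ1 E_M E_G) B.J1]
  (hi : IsSmoothEmbedding 𝓘(ℝ, ModelJ1 E_M E_G)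
    (𝓘(ℝ, E_P).prod 𝓘(ℝ, E_M →L[ℝ] E_P)) ∞ B.incl)

include hi

theorem contMDiff_tau10 : ContMDiff 𝓘(ℝ, ModelJ1 E_M E_G) 𝓘(ℝ, E_P) ∞ B.tau10 :=
  fun ρ => B.contMDiffAt_tau10_of_incl (ρ := id) hi.contMDiff.contMDiffAt (z₀ := ρ)

theorem contMDiff_tau1 : ContMDiff 𝓘(ℝ, ModelJ1 E_M E_G) 𝓘(ℝ, E_M) ∞ B.tau1 :=
  B.proj.contMDiff.comp (contMDiff_tau10 hi)

theorem contMDiff_act_J1 [IsManifold 𝓘(ℝ, ModelJ1 E_M E_G) ∞ B.J1] [IsManifold 𝓘(ℝ, E_G) ∞ G] :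
    ContMDiff (𝓘(ℝ, ModelJ1 E_M E_G).prod 𝓘(ℝ, E_G)) 𝓘(ℝ, ModelJ1 E_M E_G) ∞
      (fun q : B.J1 × G => q.1 <• q.2) :=
  hi.contMDiff_iff.2 fun q => B.contMDiffAt_incl_act (ρ := Prod.fst) (g := Prod.snd)
    (hi.contMDiff.contMDiffAt.comp q contMDiffAt_fst) contMDiffAt_snd

variable {U : Set M} {φ : PartialDiffeomorph 𝓘(ℝ, E_P) (𝓘(ℝ, E_M).prod 𝓘(ℝ, E_G)) P (M × G) ∞}

theorem IsTrivialization.contMDiffAt_gauge (hφ : B.IsTrivialization U φ) {ρ : B.J1}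
    (hρ : B.tau1 ρ ∈ U) : ContMDiffAt 𝓘(ℝ, ModelJ1 E_M E_G) 𝓘(ℝ, E_G) ∞ (gauge (B := B) φ) ρ :=
  contMDiffAt_snd.comp ρ ((φ.contMDiffAt (hφ.tau10_mem hρ)).comp ρ (contMDiff_tau10 hi ρ))

theorem IsTrivialization.contMDiffAt_normalize [IsManifold 𝓘(ℝ, ModelJ1 E_M E_G) ∞ B.J1]
    [LieGroup 𝓘(ℝ, E_G) ∞ G] (hφ : B.IsTrivialization U φ) {ρ : B.J1}
    (hρ : B.tau1 ρ ∈ U) : ContMDiffAt 𝓘(ℝ, ModelJ1 E_M E_G) 𝓘(ℝ, ModelJ1 E_M E_G) ∞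
      (normalize (B := B) φ) ρ :=
  (contMDiff_act_J1 hi).contMDiffAt.comp ρ
    (contMDiffAt_id.prodMk (hφ.contMDiffAt_gauge hi hρ).inv)

/-- An equivariant trivialization of `J¹P` over an open subset of `M`. -/
theorem exists_jetTrivialization [IsManifold 𝓘(ℝ, ModelJ1 E_M E_G) ∞ B.J1]
    [LieGroup 𝓘(ℝ, E_G) ∞ G] (ρ₀ : B.J1) :
    ∃ (W : Set M) (Θ : PartialDiffeomorph 𝓘(ℝ, ModelJ1 E_M E_G)
      (𝓘(ℝ, ModelC E_M E_G).prod 𝓘(ℝ, E_G)) B.J1 (ModelC E_M E_G × G) ∞),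
      IsOpen W ∧ B.tau1 ρ₀ ∈ W ∧ Θ.source = B.tau1 ⁻¹' W ∧ Θ.IsEquivariant := by
  obtain ⟨U, φ, hU, hφ⟩ := B.exists_isTrivialization (B.tau1 ρ₀)
  let c := chartDiffeomorph (E := E_M) ∞ (B.tau1 ρ₀)
  let k := chartDiffeomorph (E := E_G) ∞ (1 : G)
  have hk1 : (1 : G) ∈ k.source := mem_chartDiffeomorph_source ∞ _
  let Q := φ.trans (c.prodSpace k)
  have hQ : B.IsAdapted Q c := hφ.isAdapted c k
  let ψ := (B.homChart Q c hQ.proj_mem).trans (jetSplitting E_M E_G)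
  have hψ : ψ.IsSlice B.incl := hQ.isSlice
  let e := hψ.chart hi.isEmbedding ρ₀
  let W : Set M := U ∩ c.source
  let O : Set (ModelC E_M E_G) := {a | a.1 ∈ c.target ∧ c.symm a.1 ∈ U}
  -- The value `k 1` is the coordinate of the identity of `G`, so `emb` parametrizes normalized
  -- jets.
  let emb : ModelC E_M E_G → ModelJ1 E_M E_G := fun a => (a.1, k 1, a.2)
  let pr : ModelJ1 E_M E_G → ModelC E_M E_G := fun b => (b.1, b.2.2)
  have hWopen : IsOpen W := hφ.isOpen.inter c.open_source
  have hOopen : IsOpen O := by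
    have h1 : IsOpen (c.target ∩ c.symm ⁻¹' U) :=
      c.symm.contMDiffOn.continuousOn.isOpen_inter_preimage c.open_target hφ.isOpen
    exact h1.preimage continuous_fst
  have hQmem : ∀ {ρ : B.J1}, B.tau1 ρ ∈ W → gauge φ ρ = 1 → B.tau10 ρ ∈ Q.source := by
    intro ρ hρ hg
    refine ⟨hφ.tau10_mem hρ.1, ?_⟩
    show φ (B.tau10 ρ) ∈ c.source ×ˢ k.source
    rw [hφ.apply_tau10 hρ.1, hg]
    exact ⟨hρ.2, hk1⟩
  have hesrc : ∀ {ρ : B.J1}, B.tau1 ρ ∈ W → gauge φ ρ = 1 → ρ ∈ e.source :=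
    fun hρ hg => ⟨hQmem hρ hg, mem_univ _⟩
  have heapp : ∀ {ρ : B.J1}, B.tau1 ρ ∈ W → gauge φ ρ = 1 →
      e ρ = emb (pr (e ρ)) ∧ (e ρ).1 = c (B.tau1 ρ) := by
    intro ρ hρ hg
    have h1 : ((e ρ).1, (e ρ).2.1) = (c.prodSpace k) (φ (B.tau10 ρ)) := rfl
    rw [hφ.apply_tau10 hρ.1, hg] at h1
    have h2 : (e ρ).1 = c (B.tau1 ρ) := congrArg Prod.fst h1
    have h3 : (e ρ).2.1 = k 1 := congrArg Prod.snd h1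
    exact ⟨Prod.ext rfl (Prod.ext h3 rfl), h2⟩
  have hetarget : ∀ {a}, a ∈ O → emb a ∈ e.target := by
    intro a ha
    show (emb a, (0 : E_M →L[ℝ] E_M)) ∈ ψ.target
    refine ⟨mem_univ _, ?_⟩
    show ((a.1, k 1) : E_M × E_G) ∈ Q.target
    refine ⟨⟨ha.1, k.map_source hk1⟩, ?_⟩
    show (c.symm a.1, k.symm (k 1)) ∈ φ.target
    exact hφ.mem_target.2 ha.2
  have hesymm : ∀ {a}, a ∈ O → B.tau1 (e.symm (emb a)) ∈ W ∧ gauge φ (e.symm (emb a)) = 1 := by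
    intro a ha
    have h1 := e.map_target (hetarget ha)
    have h2 := e.right_inv (hetarget ha)
    set ρ := e.symm (emb a)
    have hρQ : B.tau10 ρ ∈ Q.source := h1.1
    have hρU : B.tau1 ρ ∈ U := hφ.mem_source.1 hρQ.1
    have hρck : φ (B.tau10 ρ) ∈ c.source ×ˢ k.source := hρQ.2
    rw [hφ.apply_tau10 hρU] at hρck
    refine ⟨⟨hρU, hρck.1⟩, k.injOn hρck.2 hk1 ?_⟩
    exact congrArg (fun b : ModelJ1 E_M E_G => b.2.1) h2
  have hσ : ∀ {a}, a ∈ O → ContMDiffAt 𝓘(ℝ, ModelC E_M E_G) 𝓘(ℝ, ModelJ1 E_M E_G) ∞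
      (fun a => e.symm (emb a)) a := by
    intro a ha
    -- The atlas of `J¹P` is arbitrary and `e` is not known to belong to it, so smoothness is tested
    -- in the Hom-bundle.
    rw [hi.contMDiffAt_iff]
    have h1 : ContMDiffAt 𝓘(ℝ, ModelC E_M E_G) 𝓘(ℝ, ModelJ1 E_M E_G × (E_M →L[ℝ] E_M)) ∞
        (fun a => (emb a, (0 : E_M →L[ℝ] E_M))) a := ContDiff.contMDiff (by fun_prop) a
    have h2 := (ψ.contMDiffAt_symm (hetarget ha)).comp
      (f := fun a => (emb a, (0 : E_M →L[ℝ] E_M))) a h1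
    refine h2.congr_of_eventuallyEq ?_
    filter_upwards [hOopen.mem_nhds ha] with b hb
    exact hψ.chart_symm hi.isEmbedding ρ₀ (hetarget hb)
  let Θ : PartialDiffeomorph 𝓘(ℝ, ModelJ1 E_M E_G)
      (𝓘(ℝ, ModelC E_M E_G).prod 𝓘(ℝ, E_G)) B.J1 (ModelC E_M E_G × G) ∞ :=
    -- The chart `k` sees only a neighbourhood of `1` in `G`. Normalizing before applying `e` makes
    -- the formula valid on whole orbits, that is, on all of `τ₁⁻¹(W)`.
    { toFun := fun ρ => (pr (e (normalize φ ρ)), gauge φ ρ)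
      invFun := fun q => e.symm (emb q.1) <• q.2
      source := B.tau1 ⁻¹' W
      target := O ×ˢ univ
      map_source' := by
        intro ρ hρ
        have hW : B.tau1 (normalize φ ρ) ∈ W := (tau1_normalize (φ := φ) ρ).symm ▸ hρ
        have h := (heapp hW (hφ.gauge_normalize hρ.1)).2
        rw [tau1_normalize] at h
        refine ⟨?_, mem_univ _⟩
        show (e (normalize φ ρ)).1 ∈ c.target ∧ c.symm (e (normalize φ ρ)).1 ∈ U
        rw [h]
        refine ⟨c.map_source hρ.2, ?_⟩
        have h' : c.symm (c (B.tau1 ρ)) = B.tau1 ρ := c.left_inv hρ.2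
        rw [h']
        exact hρ.1
      map_target' := by
        rintro ⟨a, g⟩ ⟨ha, -⟩
        show B.tau1 _ ∈ W
        rw [tau1_act]
        exact (hesymm ha).1
      left_inv' := by
        intro ρ hρ
        have hW : B.tau1 (normalize φ ρ) ∈ W := (tau1_normalize (φ := φ) ρ).symm ▸ hρ
        have hg := hφ.gauge_normalize (ρ := ρ) hρ.1
        show e.symm (emb (pr (e (normalize φ ρ)))) <• gauge φ ρ = ρ
        rw [← (heapp hW hg).1, e.left_inv (hesrc hW hg), normalize_act_gauge]
      right_inv' := by
        rintro ⟨a, g⟩ ⟨ha, -⟩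
        obtain ⟨hW, hg⟩ := hesymm ha
        show (pr (e (normalize φ (e.symm (emb a) <• g))), gauge φ (e.symm (emb a) <• g)) = (a, g)
        rw [hφ.normalize_act hW.1, hφ.gauge_act hW.1, hg, one_mul, normalize_eq_self hg,
          e.right_inv (hetarget ha)]
      open_source := hWopen.preimage (contMDiff_tau1 hi).continuous
      open_target := hOopen.prod isOpen_univ
      contMDiffOn_toFun := by
        intro ρ hρ
        have hW : B.tau1 (normalize φ ρ) ∈ W := (tau1_normalize (φ := φ) ρ).symm ▸ hρ
        have hg := hφ.gauge_normalize (ρ := ρ) hρ.1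
        refine ContMDiffAt.contMDiffWithinAt (ContMDiffAt.prodMk ?_ (hφ.contMDiffAt_gauge hi hρ.1))
        have h1 : ContMDiffAt 𝓘(ℝ, ModelJ1 E_M E_G) (𝓘(ℝ, E_P).prod 𝓘(ℝ, E_M →L[ℝ] E_P)) ∞
            (fun ρ => B.incl (normalize φ ρ)) ρ :=
          hi.contMDiff.contMDiffAt.comp ρ (hφ.contMDiffAt_normalize hi hρ.1)
        have h2 := (ψ.contMDiffAt (hesrc hW hg)).comp (f := fun ρ => B.incl (normalize φ ρ)) ρ h1
        have h3 : ContMDiff 𝓘(ℝ, ModelJ1 E_M E_G × (E_M →L[ℝ] E_M)) 𝓘(ℝ, ModelC E_M E_G) ∞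
            (fun b : ModelJ1 E_M E_G × (E_M →L[ℝ] E_M) => pr b.1) :=
          ContDiff.contMDiff (by fun_prop)
        exact h3.contMDiffAt.comp ρ h2
      contMDiffOn_invFun := by
        rintro ⟨a, g⟩ ⟨ha, -⟩
        refine ContMDiffAt.contMDiffWithinAt ?_
        exact (contMDiff_act_J1 hi).contMDiffAt.comp (a, g)
          (ContMDiffAt.prodMk (ContMDiffAt.comp (a, g) (hσ ha) contMDiffAt_fst)
            contMDiffAt_snd) }
  refine ⟨W, Θ, hWopen, ⟨hU, mem_chartDiffeomorph_source ∞ _⟩, rfl, ⟨O, rfl⟩, ?_, ?_⟩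
  · intro ρ hρ g
    show B.tau1 _ ∈ W
    rw [tau1_act]
    exact hρ
  · intro ρ hρ g
    show (pr (e (normalize φ (ρ <• g))), gauge φ (ρ <• g)) = _
    rw [hφ.normalize_act hρ.1, hφ.gauge_act hρ.1]

end JetStructure

end PrincipalBundle

end

noncomputable section

namespace PrincipalBundle

open Bundle ContinuousLinearMap Set Function Topology Manifold

variable {E_M E_G E_P M G P : Type*}
  [NormedAddCommGroup E_M] [NormedSpace ℝ E_M] [NormedAddCommGroup E_G] [NormedSpace ℝ E_G]
  [NormedAddCommGroup E_P] [NormedSpace ℝ E_P]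
  [TopologicalSpace M] [ChartedSpace E_M M] [IsManifold 𝓘(ℝ, E_M) ∞ M]
  [TopologicalSpace G] [ChartedSpace E_G G] [Group G]
  [TopologicalSpace P] [ChartedSpace E_P P] [IsManifold 𝓘(ℝ, E_P) ∞ P] [MulAction Gᵐᵒᵖ P]
  (B : PrincipalBundle E_M E_G E_P M G P)

/-! ### The orbit space `J¹P/G` -/

section OrbitSpace

theorem toC_eq_iff {ρ ρ' : B.J1} : B.toC ρ = B.toC ρ' ↔ ∃ g : G, ρ <• g = ρ' := by
  refine Quotient.eq.trans ⟨?_, ?_⟩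
  · rintro ⟨a, rfl⟩
    refine ⟨a.unop⁻¹, ?_⟩
    exact inv_smul_smul a ρ'
  · rintro ⟨g, rfl⟩
    exact ⟨MulOpposite.op g⁻¹, inv_smul_smul (MulOpposite.op g) ρ⟩

theorem toC_act (ρ : B.J1) (g : G) : B.toC (ρ <• g) = B.toC ρ :=
  (B.toC_eq_iff.2 ⟨g, rfl⟩).symm

theorem toC_surjective : Surjective B.toC := Quotient.mk_surjective

theorem continuous_tau10 : Continuous B.tau10 :=
  (FiberBundle.continuous_proj (E_M →L[ℝ] E_P)
    (fun p : P => (B.proj *ᵖ (TangentSpace 𝓘(ℝ, E_M) : M → Type _)) p →L[ℝ]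
      (TangentSpace 𝓘(ℝ, E_P) p : Type _))).comp B.isEmbedding_incl.continuous

theorem continuous_projC : Continuous B.projC :=
  (B.proj.contMDiff.continuous.comp B.continuous_tau10).quotient_lift _

/-- Orbit maps of actions by continuous translations are open. A smooth structure on `J¹P` is chosen
only to obtain this continuity. -/
theorem isOpenQuotientMap_toC [IsManifold 𝓘(ℝ, E_G) ∞ G] : IsOpenQuotientMap B.toC := by
  obtain ⟨_, _, hi⟩ := B.exists_isSmoothEmbedding_incl
  have : ContinuousConstSMul Gᵐᵒᵖ B.J1 :=
    ⟨fun a => (contMDiff_act_J1 hi).continuous.comp (Continuous.prodMk_left a.unop)⟩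
  exact MulAction.isOpenQuotientMap_quotientMk

theorem exists_isSubmersion_toC [LieGroup 𝓘(ℝ, E_G) ∞ G] [ChartedSpace (ModelJ1 E_M E_G) B.J1]
    [IsManifold 𝓘(ℝ, ModelJ1 E_M E_G) ∞ B.J1]
    (hi : IsSmoothEmbedding 𝓘(ℝ, ModelJ1 E_M E_G)
      (𝓘(ℝ, E_P).prod 𝓘(ℝ, E_M →L[ℝ] E_P)) ∞ B.incl) :
    ∃ _ : ChartedSpace (ModelC E_M E_G) B.C, IsManifold 𝓘(ℝ, ModelC E_M E_G) ∞ B.C ∧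
      IsSubmersion 𝓘(ℝ, ModelJ1 E_M E_G) 𝓘(ℝ, ModelC E_M E_G) ∞ B.toC := by
  refine exists_isSubmersion_of_isEquivariant (I_G := 𝓘(ℝ, E_G)) (by simp) B.isOpenQuotientMap_toC
    (fun _ _ => B.toC_eq_iff) fun ρ => ?_
  obtain ⟨W, Θ, -, hρ, hΘ, hΘe⟩ := exists_jetTrivialization hi ρ
  exact ⟨Θ, hΘ ▸ hρ, hΘe⟩

/-- Orbits over different points of `M` are separated by `p`. Orbits over the same point lie in one
equivariant trivialization, because its source is a full preimage under `τ₁`; there their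
`ModelC`-coordinates differ and can be separated. -/
theorem t2Space_C [T2Space M] [LieGroup 𝓘(ℝ, E_G) ∞ G] : T2Space B.C := by
  refine ⟨fun c c' hne => ?_⟩
  by_cases h : B.projC c = B.projC c'
  · obtain ⟨_, _, hi⟩ := B.exists_isSmoothEmbedding_incl
    obtain ⟨ρ, rfl⟩ := B.toC_surjective c
    obtain ⟨ρ', rfl⟩ := B.toC_surjective c'
    obtain ⟨W, Θ, -, hρ, hΘ, hΘe⟩ := exists_jetTrivialization hi ρ
    have hq := B.isOpenQuotientMap_toC
    have hρs : ρ ∈ Θ.source := hΘ ▸ hρ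
    have hρs' : ρ' ∈ Θ.source := by
      rw [hΘ]
      exact (show B.tau1 ρ' ∈ W from (show B.tau1 ρ = B.tau1 ρ' from h) ▸ hρ)
    have hne' : (Θ ρ).1 ≠ (Θ ρ').1 := fun he =>
      hne (B.toC_eq_iff.2 ((hΘe.fst_eq_iff hρs hρs').1 he))
    obtain ⟨u, v, hu, hv, hρu, hρv, huv⟩ := t2_separation hne'
    have hopen : ∀ {w : Set (ModelC E_M E_G)}, IsOpen w →
        IsOpen (B.toC '' (Θ.source ∩ Θ ⁻¹' (Prod.fst ⁻¹' w))) := fun hw =>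
      hq.isOpenMap _ (Θ.contMDiffOn.continuousOn.isOpen_inter_preimage Θ.open_source
        (hw.preimage continuous_fst))
    refine ⟨_, _, hopen hu, hopen hv, ⟨ρ, ⟨hρs, hρu⟩, rfl⟩, ⟨ρ', ⟨hρs', hρv⟩, rfl⟩, ?_⟩
    rw [disjoint_left]
    rintro _ ⟨σ, ⟨hσ, hσu⟩, rfl⟩ ⟨σ', ⟨hσ', hσv⟩, he⟩
    have h1 := (hΘe.fst_eq_iff hσ' hσ).2 (B.toC_eq_iff.1 he)
    refine disjoint_left.1 huv hσu ?_
    show (Θ σ).1 ∈ v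
    rw [← h1]
    exact hσv
  · exact separated_by_continuous B.continuous_projC h

theorem secondCountableTopology_C [FiniteDimensional ℝ E_M] [FiniteDimensional ℝ E_P]
    [SecondCountableTopology P] [IsManifold 𝓘(ℝ, E_G) ∞ G] : SecondCountableTopology B.C :=
  have := B.secondCountableTopology_J1
  have hq := B.isOpenQuotientMap_toC
  hq.isQuotientMap.secondCountableTopology hq.isOpenMap

end OrbitSpace

section NormalSection

variable {B}

/-- The section of `p_G` over the domain of a trivialization of `P`: the representative with
trivial `G`-component. -/
def normalSection (φ : PartialDiffeomorph 𝓘(ℝ, E_P) (𝓘(ℝ, E_M).prod 𝓘(ℝ, E_G)) P (M × G) ∞)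
    (c : B.C) : B.J1 := normalize φ (surjInv B.toC_surjective c)

variable {U : Set M} {φ : PartialDiffeomorph 𝓘(ℝ, E_P) (𝓘(ℝ, E_M).prod 𝓘(ℝ, E_G)) P (M × G) ∞}

theorem toC_normalSection (c : B.C) : B.toC (normalSection φ c) = c :=
  (B.toC_act _ _).trans (surjInv_eq B.toC_surjective c)

theorem tau1_normalSection (c : B.C) : B.tau1 (normalSection φ c) = B.projC c :=
  congrArg B.projC (toC_normalSection (φ := φ) c)

theorem IsTrivialization.normalSection_toC (hφ : B.IsTrivialization U φ) {ρ : B.J1}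
    (hρ : B.tau1 ρ ∈ U) : normalSection φ (B.toC ρ) = normalize φ ρ := by
  obtain ⟨g, hg⟩ := B.toC_eq_iff.1 (surjInv_eq B.toC_surjective (B.toC ρ)).symm
  rw [normalSection, ← hg, hφ.normalize_act hρ]

theorem IsTrivialization.gauge_normalSection (hφ : B.IsTrivialization U φ) {c : B.C}
    (hc : B.projC c ∈ U) : gauge φ (normalSection φ c) = 1 := by
  obtain ⟨ρ, rfl⟩ := B.toC_surjective c
  rw [hφ.normalSection_toC hc, hφ.gauge_normalize hc]

end NormalSection

/-! ### The principal bundle `p_G : J¹P → J¹P/G` -/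

section Descent

variable {B} [ChartedSpace (ModelJ1 E_M E_G) B.J1] [ChartedSpace (ModelC E_M E_G) B.C]
  (hi : IsSmoothEmbedding 𝓘(ℝ, ModelJ1 E_M E_G)
    (𝓘(ℝ, E_P).prod 𝓘(ℝ, E_M →L[ℝ] E_P)) ∞ B.incl)
  (hq : IsSubmersion 𝓘(ℝ, ModelJ1 E_M E_G) 𝓘(ℝ, ModelC E_M E_G) ∞ B.toC)

include hi hq in
theorem contMDiff_projC : ContMDiff 𝓘(ℝ, ModelC E_M E_G) 𝓘(ℝ, E_M) ∞ B.projC := by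
  intro c
  obtain ⟨ρ, rfl⟩ := B.toC_surjective c
  exact ContMDiffAt.of_comp_isSubmersionAt (hq.isSubmersionAt ρ) (contMDiff_tau1 hi ρ)

variable {U : Set M} {φ : PartialDiffeomorph 𝓘(ℝ, E_P) (𝓘(ℝ, E_M).prod 𝓘(ℝ, E_G)) P (M × G) ∞}

include hi hq in
-- Composed with the submersion `p_G`, the section is `normalize φ`, which is smooth and independent
-- of the representative chosen by `surjInv`.
theorem IsTrivialization.contMDiffAt_normalSection [IsManifold 𝓘(ℝ, ModelJ1 E_M E_G) ∞ B.J1]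
    [LieGroup 𝓘(ℝ, E_G) ∞ G] (hφ : B.IsTrivialization U φ) {c : B.C} (hc : B.projC c ∈ U) :
    ContMDiffAt 𝓘(ℝ, ModelC E_M E_G) 𝓘(ℝ, ModelJ1 E_M E_G) ∞ (normalSection (B := B) φ) c := by
  obtain ⟨ρ, rfl⟩ := B.toC_surjective c
  refine ContMDiffAt.of_comp_isSubmersionAt (hq.isSubmersionAt ρ) ?_
  refine (hφ.contMDiffAt_normalize hi hc).congr_of_eventuallyEq ?_
  filter_upwards [(contMDiff_tau1 hi).continuous.continuousAt.preimage_mem_nhds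
    (hφ.isOpen.mem_nhds hc)] with σ hσ using hφ.normalSection_toC hσ

include hi hq in
/-- The orbit projection is a principal bundle. -/
theorem isPrincipalBundle_toC [IsManifold 𝓘(ℝ, ModelJ1 E_M E_G) ∞ B.J1]
    [LieGroup 𝓘(ℝ, E_G) ∞ G] :
    IsPrincipalBundle (G := G) 𝓘(ℝ, ModelJ1 E_M E_G) 𝓘(ℝ, ModelC E_M E_G) 𝓘(ℝ, E_G) B.toC where
  contMDiff_act := contMDiff_act_J1 hi
  contMDiff_proj := hq.contMDiff
  proj_act := B.toC_act
  exists_trivialization c := by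
    obtain ⟨U, φ, hU, hφ⟩ := B.exists_isTrivialization (B.projC c)
    have hopen : IsOpen (B.projC ⁻¹' U) := hφ.isOpen.preimage B.continuous_projC
    refine ⟨B.projC ⁻¹' U,
      -- A trivialization of `P` over `U` induces one of `p_G` over `p⁻¹(U)`: the normalized jets
      -- are the unit section.
      { toFun := fun ρ => (B.toC ρ, gauge φ ρ)
        invFun := fun q => normalSection φ q.1 <• q.2
        source := B.toC ⁻¹' (B.projC ⁻¹' U)
        target := (B.projC ⁻¹' U) ×ˢ univ
        map_source' := fun ρ hρ => ⟨hρ, mem_univ _⟩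
        map_target' := ?_
        left_inv' := ?_
        right_inv' := ?_
        open_source := hopen.preimage hq.contMDiff.continuous
        open_target := hopen.prod isOpen_univ
        contMDiffOn_toFun := fun ρ hρ => ContMDiffAt.contMDiffWithinAt
          (hq.contMDiff.contMDiffAt.prodMk (hφ.contMDiffAt_gauge hi hρ))
        contMDiffOn_invFun := ?_ }, hopen, hU, rfl, rfl, fun _ _ => rfl,
        fun ρ hρ g => hφ.gauge_act hρ g⟩
    · rintro ⟨b, g⟩ ⟨hb, -⟩
      show B.projC (B.toC (normalSection φ b <• g)) ∈ U
      rw [toC_act, toC_normalSection]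
      exact hb
    · intro ρ hρ
      show normalSection φ (B.toC ρ) <• gauge φ ρ = ρ
      rw [hφ.normalSection_toC hρ, normalize_act_gauge]
    · rintro ⟨b, g⟩ ⟨hb, -⟩
      have hb' : B.tau1 (normalSection φ b) ∈ U := (tau1_normalSection (φ := φ) b).symm ▸ hb
      show (B.toC (normalSection φ b <• g), gauge φ (normalSection φ b <• g)) = (b, g)
      rw [toC_act, toC_normalSection, hφ.gauge_act hb', hφ.gauge_normalSection hb, one_mul]
    · rintro ⟨b, g⟩ ⟨hb, -⟩
      exact ((contMDiff_act_J1 hi).contMDiffAt.comp (b, g)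
        (ContMDiffAt.prodMk (ContMDiffAt.comp (b, g) (hφ.contMDiffAt_normalSection hi hq hb)
          contMDiffAt_fst) contMDiffAt_snd)).contMDiffWithinAt

end Descent

end PrincipalBundle

end

noncomputable section

namespace PrincipalBundle

open Bundle ContinuousLinearMap Set Function Topology Manifold

variable {E_M E_G E_P M G P : Type*}
  [NormedAddCommGroup E_M] [NormedSpace ℝ E_M] [NormedAddCommGroup E_G] [NormedSpace ℝ E_G]
  [NormedAddCommGroup E_P] [NormedSpace ℝ E_P]
  [TopologicalSpace M] [ChartedSpace E_M M] [IsManifold 𝓘(ℝ, E_M) ∞ M]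
  [TopologicalSpace G] [ChartedSpace E_G G] [Group G]
  [TopologicalSpace P] [ChartedSpace E_P P] [IsManifold 𝓘(ℝ, E_P) ∞ P] [MulAction Gᵐᵒᵖ P]
  {B : PrincipalBundle E_M E_G E_P M G P}

/-! ### The pullback `p^*P` as an embedded submanifold -/

section PullbackStructure

variable [ChartedSpace (ModelC E_M E_G) B.C]

/-- The chart of `J¹P/G × P` given by charts `κ` of `J¹P/G` and adapted charts `Q` of `P`, `c` of
`M`, in which `p^*P` is the zero set of the last coordinate. -/
def pullbackChart (hp : ContMDiff 𝓘(ℝ, ModelC E_M E_G) 𝓘(ℝ, E_M) ∞ B.projC)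
    (κ : PartialDiffeomorph 𝓘(ℝ, ModelC E_M E_G) 𝓘(ℝ, ModelC E_M E_G) B.C (ModelC E_M E_G) ∞)
    (Q : PartialDiffeomorph 𝓘(ℝ, E_P) 𝓘(ℝ, E_M × E_G) P (E_M × E_G) ∞)
    (c : PartialDiffeomorph 𝓘(ℝ, E_M) 𝓘(ℝ, E_M) M E_M ∞) :
    PartialDiffeomorph (𝓘(ℝ, ModelC E_M E_G).prod 𝓘(ℝ, E_P)) 𝓘(ℝ, ModelJ1 E_M E_G × E_M)
      (B.C × P) (ModelJ1 E_M E_G × E_M) ∞ := by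
  let f : B.C → E_M := fun b => c (B.projC b)
  let r : ModelJ1 E_M E_G × E_M → B.C := fun a => κ.symm (a.1.1, a.1.2.2)
  -- Once `b = r a` is recovered, the base coordinate of `u` is the defect `a.2` plus the coordinate
  -- of `p(b)`.
  let h : ModelJ1 E_M E_G × E_M → E_M × E_G := fun a => (a.2 + f (r a), a.1.2.1)
  let O : Set (ModelJ1 E_M E_G × E_M) :=
    {a | (a.1.1, a.1.2.2) ∈ κ.target ∧ B.projC (r a) ∈ c.source}
  have hpr : ContMDiff 𝓘(ℝ, ModelJ1 E_M E_G × E_M) 𝓘(ℝ, ModelC E_M E_G) ∞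
      (fun a : ModelJ1 E_M E_G × E_M => ((a.1.1, a.1.2.2) : ModelC E_M E_G)) :=
    ContDiff.contMDiff (by fun_prop)
  have hr : ContMDiffOn 𝓘(ℝ, ModelJ1 E_M E_G × E_M) 𝓘(ℝ, ModelC E_M E_G) ∞ r
      {a | (a.1.1, a.1.2.2) ∈ κ.target} :=
    κ.symm.contMDiffOn.comp hpr.contMDiffOn fun _ ha => ha
  have hO : IsOpen O :=
    (hp.continuous.comp_continuousOn hr.continuousOn).isOpen_inter_preimage
      (κ.open_target.preimage hpr.continuous) c.open_source
  have hf : ContMDiffOn 𝓘(ℝ, ModelC E_M E_G) 𝓘(ℝ, E_M) ∞ f (B.projC ⁻¹' c.source) :=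
    c.contMDiffOn.comp hp.contMDiffOn fun _ hb => hb
  have hh : ContMDiffOn 𝓘(ℝ, ModelJ1 E_M E_G × E_M) 𝓘(ℝ, E_M × E_G) ∞ h O := by
    refine ContMDiffOn.prodMk_space (ContMDiffOn.add ?_ ?_) ?_
    · exact (ContDiff.contMDiff (f := fun a : ModelJ1 E_M E_G × E_M => a.2)
        (by fun_prop)).contMDiffOn
    · exact hf.comp (hr.mono fun _ ha => ha.1) fun _ ha => ha.2
    · exact (ContDiff.contMDiff (f := fun a : ModelJ1 E_M E_G × E_M => a.1.2.1)
        (by fun_prop)).contMDiffOn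
  exact
  { toFun := fun q => (((κ q.1).1, (Q q.2).2, (κ q.1).2), (Q q.2).1 - f q.1)
    invFun := fun a => (r a, Q.symm (h a))
    source := (κ.source ∩ B.projC ⁻¹' c.source) ×ˢ Q.source
    target := O ∩ h ⁻¹' Q.target
    map_source' := by
      rintro ⟨b, u⟩ ⟨⟨hb, hbc⟩, hu⟩
      have h1 : r (((κ b).1, (Q u).2, (κ b).2), (Q u).1 - f b) = b := κ.left_inv hb
      refine ⟨⟨κ.map_source hb, ?_⟩, ?_⟩
      · show B.projC (r _) ∈ c.source
        rw [h1]
        exact hbc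
      · show ((Q u).1 - f b + f (r (((κ b).1, (Q u).2, (κ b).2), (Q u).1 - f b)), (Q u).2) ∈ Q.target
        rw [h1, sub_add_cancel]
        exact Q.map_source hu
    map_target' := fun a ha => ⟨⟨κ.map_target ha.1.1, ha.1.2⟩, Q.map_target ha.2⟩
    left_inv' := by
      rintro ⟨b, u⟩ ⟨⟨hb, hbc⟩, hu⟩
      have h1 : r (((κ b).1, (Q u).2, (κ b).2), (Q u).1 - f b) = b := κ.left_inv hb
      refine Prod.ext h1 ?_
      show Q.symm ((Q u).1 - f b + f (r (((κ b).1, (Q u).2, (κ b).2), (Q u).1 - f b)), (Q u).2) = u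
      rw [h1, sub_add_cancel]
      exact Q.left_inv hu
    right_inv' := by
      rintro a ⟨⟨ha, hac⟩, haQ⟩
      have h1 : κ (r a) = (a.1.1, a.1.2.2) := κ.right_inv ha
      have h2 : Q (Q.symm (h a)) = h a := Q.right_inv haQ
      show (((κ (r a)).1, (Q (Q.symm (h a))).2, (κ (r a)).2),
        (Q (Q.symm (h a))).1 - f (r a)) = a
      rw [h1, h2]
      exact Prod.ext rfl (add_sub_cancel_right _ _)
    open_source := (κ.open_source.inter (c.open_source.preimage hp.continuous)).prod Q.open_source
    open_target := hh.continuousOn.isOpen_inter_preimage hO Q.open_target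
    contMDiffOn_toFun := by
      have hκ : ContMDiffOn (𝓘(ℝ, ModelC E_M E_G).prod 𝓘(ℝ, E_P)) 𝓘(ℝ, ModelC E_M E_G) ∞
          (fun q : B.C × P => κ q.1) ((κ.source ∩ B.projC ⁻¹' c.source) ×ˢ Q.source) :=
        κ.contMDiffOn.comp contMDiffOn_fst fun _ hq => hq.1.1
      have hQ : ContMDiffOn (𝓘(ℝ, ModelC E_M E_G).prod 𝓘(ℝ, E_P)) 𝓘(ℝ, E_M × E_G) ∞
          (fun q : B.C × P => Q q.2) ((κ.source ∩ B.projC ⁻¹' c.source) ×ˢ Q.source) :=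
        Q.contMDiffOn.comp contMDiffOn_snd fun _ hq => hq.2
      have hf' : ContMDiffOn (𝓘(ℝ, ModelC E_M E_G).prod 𝓘(ℝ, E_P)) 𝓘(ℝ, E_M) ∞
          (fun q : B.C × P => f q.1) ((κ.source ∩ B.projC ⁻¹' c.source) ×ˢ Q.source) :=
        hf.comp contMDiffOn_fst fun _ hq => hq.1.2
      have hF : ContMDiff 𝓘(ℝ, ModelC E_M E_G × (E_M × E_G) × E_M)
          𝓘(ℝ, ModelJ1 E_M E_G × E_M) ∞
          (fun y : ModelC E_M E_G × (E_M × E_G) × E_M =>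
            (((y.1.1, y.2.1.2, y.1.2), y.2.1.1 - y.2.2) : ModelJ1 E_M E_G × E_M)) :=
        ContDiff.contMDiff (by fun_prop)
      exact hF.comp_contMDiffOn (hκ.prodMk_space (hQ.prodMk_space hf'))
    contMDiffOn_invFun := ContMDiffOn.prodMk (hr.mono fun _ ha => ha.1.1)
      (Q.symm.contMDiffOn.comp (hh.mono inter_subset_left) fun _ ha => ha.2) }

/-- Adaptedness makes the last coordinate `c (τ u) - c (p b)`, and `c` is injective on its source,
so it vanishes exactly on `p^*P`. -/
theorem IsAdapted.isSlice_pullbackChart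
    (hp : ContMDiff 𝓘(ℝ, ModelC E_M E_G) 𝓘(ℝ, E_M) ∞ B.projC)
    (κ : PartialDiffeomorph 𝓘(ℝ, ModelC E_M E_G) 𝓘(ℝ, ModelC E_M E_G) B.C (ModelC E_M E_G) ∞)
    {Q : PartialDiffeomorph 𝓘(ℝ, E_P) 𝓘(ℝ, E_M × E_G) P (E_M × E_G) ∞}
    {c : PartialDiffeomorph 𝓘(ℝ, E_M) 𝓘(ℝ, E_M) M E_M ∞} (h : B.IsAdapted Q c) :
    (pullbackChart hp κ Q c).IsSlice B.pullbackIncl where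
  snd_eq_zero q hq := by
    refine sub_eq_zero.2 ((h.fst_eq _ hq.2).trans (congrArg c ?_))
    exact q.2.symm
  exists_eq a ha := by
    have hm := (pullbackChart hp κ Q c).map_target ha
    have hr := congrArg Prod.snd ((pullbackChart hp κ Q c).right_inv ha)
    set q := (pullbackChart hp κ Q c).symm (a, 0)
    have hr' : (Q q.2).1 - c (B.projC q.1) = 0 := hr
    refine ⟨⟨q, c.injOn hm.1.2 (h.proj_mem _ hm.2) ?_⟩, rfl⟩
    exact (sub_eq_zero.1 hr').symm.trans (h.fst_eq _ hm.2)

theorem exists_isSmoothEmbedding_pullbackIncl [IsManifold 𝓘(ℝ, E_G) ∞ G]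
    [IsManifold 𝓘(ℝ, ModelC E_M E_G) ∞ B.C]
    (hp : ContMDiff 𝓘(ℝ, ModelC E_M E_G) 𝓘(ℝ, E_M) ∞ B.projC) :
    ∃ _ : ChartedSpace (ModelJ1 E_M E_G) B.Pullback,
      IsManifold 𝓘(ℝ, ModelJ1 E_M E_G) ∞ B.Pullback ∧
      IsSmoothEmbedding 𝓘(ℝ, ModelJ1 E_M E_G)
        (𝓘(ℝ, ModelC E_M E_G).prod 𝓘(ℝ, E_P)) ∞ B.pullbackIncl := by
  refine exists_isSmoothEmbedding_of_isSlice (K := E_M) (by simp) IsEmbedding.subtypeVal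
    fun q => ?_
  obtain ⟨Q, hQ, hQc⟩ := B.exists_isAdapted (B.pullbackIncl q).2
  refine ⟨_, ?_, hQc.isSlice_pullbackChart hp
    (chartDiffeomorph (E := ModelC E_M E_G) ∞ (B.pullbackIncl q).1)⟩
  refine ⟨⟨mem_chartDiffeomorph_source ∞ _, ?_⟩, hQ⟩
  rw [mem_preimage, show B.projC (B.pullbackIncl q).1 = B.proj (B.pullbackIncl q).2 from q.2]
  exact mem_chartDiffeomorph_source ∞ _

end PullbackStructure

/-! ### A jet is determined by its orbit and its base point -/

section PullbackSet

variable {U : Set M} {φ : PartialDiffeomorph 𝓘(ℝ, E_P) (𝓘(ℝ, E_M).prod 𝓘(ℝ, E_G)) P (M × G) ∞}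

theorem projC_pullbackProj (q : B.Pullback) : B.projC (B.pullbackProj q) =
    B.proj (B.pullbackIncl q).2 := q.2

theorem toPullback_act (ρ : B.J1) (g : G) : B.toPullback (ρ <• g) = B.toPullback ρ <• g :=
  Subtype.ext (Prod.ext (B.toC_act ρ g) rfl)

/-- The left side involves only the orbit of `ρ` and its base point; this is the local formula for
the inverse of `toPullback`. -/
theorem IsTrivialization.normalSection_act_snd (hφ : B.IsTrivialization U φ) {ρ : B.J1}
    (hρ : B.tau1 ρ ∈ U) : normalSection φ (B.toC ρ) <• (φ (B.tau10 ρ)).2 = ρ := by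
  rw [hφ.normalSection_toC hρ]
  exact normalize_act_gauge ρ

/-- Injectivity is the reconstruction formula. For surjectivity, the normalized jet of the orbit is
translated by the `G`-component of `u`; its base point then has the same image under `φ` as `u`. -/
theorem bijective_toPullback : Bijective B.toPullback := by
  constructor
  · intro ρ ρ' h
    have h1 : B.toC ρ = B.toC ρ' := congrArg B.pullbackProj h
    have h2 : B.tau10 ρ = B.tau10 ρ' := congrArg (fun q => (B.pullbackIncl q).2) h
    obtain ⟨U, φ, hU, hφ⟩ := B.exists_isTrivialization (B.tau1 ρ)
    have hU' : B.tau1 ρ' ∈ U := (show B.tau1 ρ = B.tau1 ρ' from congrArg B.projC h1) ▸ hU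
    rw [← hφ.normalSection_act_snd hU, ← hφ.normalSection_act_snd hU', h1, h2]
  · intro q
    obtain ⟨U, φ, hU, hφ⟩ := B.exists_isTrivialization (B.projC (B.pullbackProj q))
    have hU' : B.tau1 (normalSection φ (B.pullbackProj q)) ∈ U :=
      (tau1_normalSection (φ := φ) _).symm ▸ hU
    have hq : (B.pullbackIncl q).2 ∈ φ.source := hφ.mem_source.2 (projC_pullbackProj q ▸ hU)
    let ρ := normalSection φ (B.pullbackProj q) <• (φ (B.pullbackIncl q).2).2
    have hρ : B.tau1 ρ ∈ U := (B.tau1_act _ _).symm ▸ hU'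
    refine ⟨ρ, Subtype.ext (Prod.ext ((B.toC_act _ _).trans (toC_normalSection _)) ?_)⟩
    refine φ.injOn (hφ.tau10_mem hρ) hq ?_
    refine (hφ.apply_tau10 hρ).trans (Prod.ext ?_ ?_)
    · refine (B.tau1_act _ _).trans ((tau1_normalSection _).trans ?_)
      exact (projC_pullbackProj q).trans (hφ.fst_eq _ hq).symm
    · rw [hφ.gauge_act hU', hφ.gauge_normalSection hU, one_mul]
      rfl

end PullbackSet

/-! ### The principal bundle `p^*P` and the isomorphism with `J¹P` -/

section PullbackBundle

variable [ChartedSpace (ModelC E_M E_G) B.C] [ChartedSpace (ModelJ1 E_M E_G) B.Pullback]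

/-- The pullback of `P` to `J¹P/G` is a principal bundle. -/
theorem isPrincipalBundle_pullbackProj
    (hp : ContMDiff 𝓘(ℝ, ModelC E_M E_G) 𝓘(ℝ, E_M) ∞ B.projC)
    (hj : IsSmoothEmbedding 𝓘(ℝ, ModelJ1 E_M E_G)
      (𝓘(ℝ, ModelC E_M E_G).prod 𝓘(ℝ, E_P)) ∞ B.pullbackIncl) :
    IsPrincipalBundle (G := G) 𝓘(ℝ, ModelJ1 E_M E_G) 𝓘(ℝ, ModelC E_M E_G) 𝓘(ℝ, E_G)
      B.pullbackProj where
  contMDiff_act := by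
    have h1 : ContMDiff (𝓘(ℝ, ModelJ1 E_M E_G).prod 𝓘(ℝ, E_G))
        (𝓘(ℝ, ModelC E_M E_G).prod 𝓘(ℝ, E_P)) ∞
        (fun q : B.Pullback × G => B.pullbackIncl q.1) := hj.contMDiff.comp contMDiff_fst
    exact hj.contMDiff_iff.2 ((contMDiff_fst.comp h1).prodMk
      (B.isPrincipalBundle.contMDiff_act.comp ((contMDiff_snd.comp h1).prodMk contMDiff_snd)))
  contMDiff_proj := contMDiff_fst.comp hj.contMDiff
  proj_act _ _ := rfl
  exists_trivialization c := by
    obtain ⟨U, φ, hU, hφ⟩ := B.exists_isTrivialization (B.projC c)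
    have hopen : IsOpen (B.projC ⁻¹' U) := hφ.isOpen.preimage B.continuous_projC
    have hmem : ∀ {q : B.Pullback}, B.projC (B.pullbackProj q) ∈ U →
        (B.pullbackIncl q).2 ∈ φ.source := fun {q} hq =>
      hφ.mem_source.2 (projC_pullbackProj q ▸ hq)
    classical
    -- Off `p⁻¹(U)` the value is an arbitrary point of `p^*P`.
    let inv : B.C × G → B.Pullback := fun b =>
      if hb : B.projC b.1 ∈ U then ⟨(b.1, φ.symm (B.projC b.1, b.2)), (hφ.proj_symm hb).symm⟩
      else B.toPullback (surjInv B.toC_surjective b.1)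
    have hinv : ∀ {b : B.C × G}, B.projC b.1 ∈ U →
        B.pullbackIncl (inv b) = (b.1, φ.symm (B.projC b.1, b.2)) := by
      intro b hb
      exact congrArg B.pullbackIncl (dif_pos hb)
    refine ⟨B.projC ⁻¹' U,
      { toFun := fun q => (B.pullbackProj q, (φ (B.pullbackIncl q).2).2)
        invFun := inv
        source := B.pullbackProj ⁻¹' (B.projC ⁻¹' U)
        target := (B.projC ⁻¹' U) ×ˢ univ
        map_source' := fun q hq => ⟨hq, mem_univ _⟩
        map_target' := ?_
        left_inv' := ?_
        right_inv' := ?_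
        open_source := hopen.preimage (contMDiff_fst.comp hj.contMDiff).continuous
        open_target := hopen.prod isOpen_univ
        contMDiffOn_toFun := ?_
        contMDiffOn_invFun := ?_ }, hopen, hU, rfl, rfl, fun _ _ => rfl,
        fun q hq g => hφ.snd_act _ (hmem hq) g⟩
    · rintro b ⟨hb, -⟩
      show B.projC (B.pullbackIncl (inv b)).1 ∈ U
      rw [hinv hb]
      exact hb
    · intro q hq
      refine hj.isEmbedding.injective ((hinv (b := (B.pullbackProj q, (φ (B.pullbackIncl q).2).2)) hq).trans
        (Prod.ext rfl ?_))
      show φ.symm (B.projC (B.pullbackProj q), (φ (B.pullbackIncl q).2).2) = _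
      rw [projC_pullbackProj, ← hφ.fst_eq _ (hmem hq)]
      exact φ.left_inv (hmem hq)
    · rintro ⟨b, g⟩ ⟨hb, -⟩
      have h1 := hinv (b := (b, g)) hb
      show ((B.pullbackIncl (inv (b, g))).1, (φ (B.pullbackIncl (inv (b, g))).2).2) = (b, g)
      rw [h1]
      have h2 : φ (φ.symm (B.projC b, g)) = (B.projC b, g) := φ.right_inv (hφ.mem_target.2 hb)
      simp only [h2]
    · intro q hq
      refine ContMDiffAt.contMDiffWithinAt (ContMDiffAt.prodMk
        (contMDiffAt_fst.comp q hj.contMDiff.contMDiffAt) ?_)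
      exact contMDiffAt_snd.comp q ((φ.contMDiffAt (hmem hq)).comp q
        (contMDiffAt_snd.comp q hj.contMDiff.contMDiffAt))
    · rintro ⟨b, g⟩ ⟨hb, -⟩
      refine ContMDiffAt.contMDiffWithinAt (hj.contMDiffAt_iff.2 ?_)
      have h1 : ContMDiffAt (𝓘(ℝ, ModelC E_M E_G).prod 𝓘(ℝ, E_G))
          (𝓘(ℝ, ModelC E_M E_G).prod 𝓘(ℝ, E_P)) ∞
          (fun b : B.C × G => (b.1, φ.symm (B.projC b.1, b.2))) (b, g) :=
        contMDiffAt_fst.prodMk ((φ.contMDiffAt_symm (hφ.mem_target.2 hb)).comp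
          (f := fun b : B.C × G => (B.projC b.1, b.2)) (b, g)
          ((hp.comp contMDiff_fst).prodMk contMDiff_snd).contMDiffAt)
      refine h1.congr_of_eventuallyEq ?_
      filter_upwards [(hopen.prod isOpen_univ).mem_nhds (⟨hb, mem_univ _⟩ :
        (b, g) ∈ (B.projC ⁻¹' U) ×ˢ (univ : Set G))] with b' hb' using hinv hb'.1

/-- `J¹P` is isomorphic to the pullback of `P` to `J¹P/G`. -/
theorem isPrincipalBundleIso_toPullback [ChartedSpace (ModelJ1 E_M E_G) B.J1]
    [IsManifold 𝓘(ℝ, ModelJ1 E_M E_G) ∞ B.J1]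
    [LieGroup 𝓘(ℝ, E_G) ∞ G]
    (hi : IsSmoothEmbedding 𝓘(ℝ, ModelJ1 E_M E_G)
      (𝓘(ℝ, E_P).prod 𝓘(ℝ, E_M →L[ℝ] E_P)) ∞ B.incl)
    (hq : IsSubmersion 𝓘(ℝ, ModelJ1 E_M E_G) 𝓘(ℝ, ModelC E_M E_G) ∞ B.toC)
    (hj : IsSmoothEmbedding 𝓘(ℝ, ModelJ1 E_M E_G)
      (𝓘(ℝ, ModelC E_M E_G).prod 𝓘(ℝ, E_P)) ∞ B.pullbackIncl) :
    IsPrincipalBundleIso G 𝓘(ℝ, ModelJ1 E_M E_G) 𝓘(ℝ, ModelJ1 E_M E_G) B.toC B.pullbackProj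
      B.toPullback where
  diffeomorph := by
    let e := Equiv.ofBijective B.toPullback bijective_toPullback
    refine ⟨{ toEquiv := e, contMDiff_toFun := ?_, contMDiff_invFun := ?_ }, rfl⟩
    · exact hj.contMDiff_iff.2 (hq.contMDiff.prodMk (contMDiff_tau10 hi))
    · intro q
      obtain ⟨U, φ, hU, hφ⟩ := B.exists_isTrivialization (B.projC (B.pullbackProj q))
      have hqφ : (B.pullbackIncl q).2 ∈ φ.source := hφ.mem_source.2 (projC_pullbackProj q ▸ hU)
      have hpr : ContMDiffAt 𝓘(ℝ, ModelJ1 E_M E_G) 𝓘(ℝ, ModelC E_M E_G) ∞ B.pullbackProj q :=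
        contMDiffAt_fst.comp q hj.contMDiff.contMDiffAt
      -- Near `q` the set-theoretic inverse equals this visibly smooth expression.
      have h1 : ContMDiffAt 𝓘(ℝ, ModelJ1 E_M E_G) 𝓘(ℝ, ModelJ1 E_M E_G) ∞
          (fun q => normalSection φ (B.pullbackProj q) <• (φ (B.pullbackIncl q).2).2) q :=
        (contMDiff_act_J1 hi).contMDiffAt.comp q (ContMDiffAt.prodMk
          ((hφ.contMDiffAt_normalSection hi hq hU).comp q hpr)
          (contMDiffAt_snd.comp q ((φ.contMDiffAt hqφ).comp q
            (contMDiffAt_snd.comp q hj.contMDiff.contMDiffAt))))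
      refine h1.congr_of_eventuallyEq ?_
      filter_upwards [(B.continuous_projC.continuousAt.comp hpr.continuousAt).preimage_mem_nhds
        (hφ.isOpen.mem_nhds hU)] with q' hq'
      obtain ⟨ρ, rfl⟩ := bijective_toPullback.2 q'
      refine (e.symm_apply_apply ρ).trans ?_
      exact (hφ.normalSection_act_snd hq').symm
  proj_comp _ := rfl
  map_act := toPullback_act

end PullbackBundle

end PrincipalBundle

end

noncomputable section

/-! ### Realizing jets by local sections, and the main theorem -/

namespace PrincipalBundle

open Bundle ContinuousLinearMap Set Function Topology Manifold

variable {E_M E_G E_P M G P : Type*}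
  [NormedAddCommGroup E_M] [NormedSpace ℝ E_M] [NormedAddCommGroup E_G] [NormedSpace ℝ E_G]
  [NormedAddCommGroup E_P] [NormedSpace ℝ E_P]
  [TopologicalSpace M] [ChartedSpace E_M M] [IsManifold 𝓘(ℝ, E_M) ∞ M]
  [TopologicalSpace G] [ChartedSpace E_G G] [Group G]
  [TopologicalSpace P] [ChartedSpace E_P P] [IsManifold 𝓘(ℝ, E_P) ∞ P] [MulAction Gᵐᵒᵖ P]
  (B : PrincipalBundle E_M E_G E_P M G P)

/-- Every element of `J¹P` is the `1`-jet of a local section. -/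
theorem exists_jet_eq [IsManifold 𝓘(ℝ, E_G) ∞ G] (ρ : B.J1) :
    ∃ (s : M → P) (x : M) (hs : B.IsLocalSectionAt s x), B.jet s x hs = ρ := by
  obtain ⟨Q, hu, hQ⟩ := B.exists_isAdapted (B.tau10 ρ)
  set u := B.tau10 ρ with hu_def
  set x := B.proj u with hx_def
  set c := chartDiffeomorph (E := E_M) ∞ x
  have hx : x ∈ c.source := mem_chartDiffeomorph_source ∞ x
  let L : E_M →L[ℝ] E_M × E_G := (B.homChart Q c hQ.proj_mem (B.incl ρ)).2
  have hL : ∀ v, (L v).1 = v := fun v => congrArg (fun A : E_M →L[ℝ] E_M => A v)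
    ((B.fst_comp_homChart_eq_id_iff Q c hQ.proj_mem hQ.fst_eq hu).2 ρ.2)
  -- In coordinates the section is the affine map through `Q u` with derivative `L`. Its first
  -- component is the identity, since that of `L` is and `(Q u).1 = c x`, so it does define a
  -- section.
  let a : E_M → E_M × E_G := fun y => Q u + L (y - c x)
  have ha : ContMDiff 𝓘(ℝ, E_M) 𝓘(ℝ, E_M × E_G) ∞ a :=
    ContDiff.contMDiff (contDiff_const.add (L.contDiff.comp (contDiff_id.sub contDiff_const)))
  have hax : a (c x) = Q u := by simp [a]
  let s : M → P := fun y => Q.symm (a (c y))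
  have hsx : s x = u := (congrArg Q.symm hax).trans (Q.left_inv hu)
  let V : Set M := c.source ∩ (fun y => a (c y)) ⁻¹' Q.target
  have hac : ContMDiffOn 𝓘(ℝ, E_M) 𝓘(ℝ, E_M × E_G) ∞ (fun y => a (c y)) c.source :=
    ha.comp_contMDiffOn c.contMDiffOn
  have hV : IsOpen V := hac.continuousOn.isOpen_inter_preimage c.open_source Q.open_target
  have haxt : a (c x) ∈ Q.target := hax ▸ Q.map_source hu
  have hxV : x ∈ V := ⟨hx, haxt⟩
  have hs : B.IsLocalSectionAt s x := by
    refine ⟨V, hV, hxV,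
      Q.symm.contMDiffOn.comp (hac.mono inter_subset_left) fun _ hy => hy.2, fun y hy => ?_⟩
    have hm : s y ∈ Q.source := Q.map_target hy.2
    refine c.injOn (hQ.proj_mem _ hm) hy.1 ((hQ.fst_eq _ hm).symm.trans ?_)
    have h1 : Q (s y) = a (c y) := Q.right_inv hy.2
    rw [h1]
    show (Q u).1 + (L (c y - c x)).1 = c y
    rw [hL, hQ.fst_eq u hu]
    exact add_sub_cancel _ _
  have hderiv : (mfderiv 𝓘(ℝ, E_M) 𝓘(ℝ, E_P) s x : E_M →L[ℝ] E_P) = (B.incl ρ).2 := by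
    have hc' := (c.contMDiffAt hx).mdifferentiableAt (by simp)
    have ha' : MDifferentiableAt 𝓘(ℝ, E_M) 𝓘(ℝ, E_M × E_G) a (c x) :=
      ha.mdifferentiable (by simp) _
    have h1 := mfderiv_comp x ha' hc'
    have h2 := mfderiv_comp (f := a ∘ c) x ((Q.contMDiffAt_symm haxt).mdifferentiableAt (by simp))
      (ha'.comp x hc')
    have h3 : (mfderiv 𝓘(ℝ, E_M) 𝓘(ℝ, E_M × E_G) a (c x) : E_M →L[ℝ] E_M × E_G) = L := by
      have h4 : HasFDerivAt a L (c x) :=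
        (L.hasFDerivAt.comp (c x) ((hasFDerivAt_id (c x)).sub_const (c x))).const_add (Q u)
      exact h4.hasMFDerivAt.mfderiv
    have h5 : (mfderiv 𝓘(ℝ, E_M × E_G) 𝓘(ℝ, E_P) Q.symm (a (c x)) : E_M × E_G →L[ℝ] E_P) =
        mfderiv 𝓘(ℝ, E_M × E_G) 𝓘(ℝ, E_P) Q.symm (Q u) := by rw [hax]
    have hQl : ∀ w : E_P, (mfderiv 𝓘(ℝ, E_M × E_G) 𝓘(ℝ, E_P) Q.symm (Q u) :
        E_M × E_G →L[ℝ] E_P) ((mfderiv 𝓘(ℝ, E_P) 𝓘(ℝ, E_M × E_G) Q u :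
        E_P →L[ℝ] E_M × E_G) w) = w := fun w => congrArg (fun A : E_P →L[ℝ] E_P => A w)
      (Q.mfderiv_symm_comp_mfderiv (by simp) hu)
    have hcl : ∀ v : E_M, (mfderiv 𝓘(ℝ, E_M) 𝓘(ℝ, E_M) c.symm (c x) : E_M →L[ℝ] E_M)
        ((mfderiv 𝓘(ℝ, E_M) 𝓘(ℝ, E_M) c x : E_M →L[ℝ] E_M) v) = v :=
      fun v => congrArg (fun A : E_M →L[ℝ] E_M => A v)
        (c.mfderiv_symm_comp_mfderiv (by simp) hx)
    have h6 : (mfderiv 𝓘(ℝ, E_M) 𝓘(ℝ, E_P) s x : E_M →L[ℝ] E_P) =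
        (mfderiv 𝓘(ℝ, E_M × E_G) 𝓘(ℝ, E_P) Q.symm (Q u) : E_M × E_G →L[ℝ] E_P).comp
          (L.comp (mfderiv 𝓘(ℝ, E_M) 𝓘(ℝ, E_M) c x : E_M →L[ℝ] E_M)) := by
      rw [← h5, ← h3]
      exact h2.trans (congrArg _ h1)
    -- The derivatives of `Q` and `c` built into `L` cancel against those of the charts used to
    -- define `s`.
    rw [h6]
    ext v
    refine Eq.trans ?_ (hQl ((B.incl ρ).2 v))
    exact congrArg (fun w : E_M => (mfderiv 𝓘(ℝ, E_M × E_G) 𝓘(ℝ, E_P) Q.symm (Q u) :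
      E_M × E_G →L[ℝ] E_P) ((mfderiv 𝓘(ℝ, E_P) 𝓘(ℝ, E_M × E_G) Q u :
      E_P →L[ℝ] E_M × E_G) (((B.incl ρ).2 : E_M →L[ℝ] E_P) w))) (hcl v)
  refine ⟨s, x, hs, Subtype.ext (TotalSpace.ext hsx (heq_of_eq hderiv))⟩

end PrincipalBundle

end

theorem mainTheorem9
    {E_M E_G E_P : Type*}
    [NormedAddCommGroup E_M] [NormedSpace ℝ E_M] [FiniteDimensional ℝ E_M]
    [NormedAddCommGroup E_G] [NormedSpace ℝ E_G] [FiniteDimensional ℝ E_G]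
    [NormedAddCommGroup E_P] [NormedSpace ℝ E_P] [FiniteDimensional ℝ E_P]
    {M G P : Type*}
    [TopologicalSpace M] [T2Space M] [SecondCountableTopology M]
    [ChartedSpace E_M M] [IsManifold 𝓘(ℝ, E_M) ∞ M]
    [TopologicalSpace G] [T2Space G] [SecondCountableTopology G]
    [ChartedSpace E_G G] [Group G] [LieGroup 𝓘(ℝ, E_G) ∞ G]
    [TopologicalSpace P] [T2Space P] [SecondCountableTopology P]
    [ChartedSpace E_P P] [IsManifold 𝓘(ℝ, E_P) ∞ P] [MulAction Gᵐᵒᵖ P]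
    (B : PrincipalBundle E_M E_G E_P M G P) :
    -- `J¹P` and `J¹P/G` are Hausdorff and second countable, and (with `p^*P`) smooth manifolds
    (T2Space B.J1 ∧ SecondCountableTopology B.J1 ∧ T2Space B.C ∧ SecondCountableTopology B.C) ∧
    (∃ (_ : ChartedSpace (PrincipalBundle.ModelJ1 E_M E_G) B.J1)
      (_ : ChartedSpace (PrincipalBundle.ModelC E_M E_G) B.C)
      (_ : ChartedSpace (PrincipalBundle.ModelJ1 E_M E_G) B.Pullback),
      B.IsStandardSmoothStructure) ∧
    -- the points of `J¹P` are the `1`-jets of local sections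
    (∀ ρ : B.J1, ∃ (s : M → P) (x : M) (hs : B.IsLocalSectionAt s x), B.jet s x hs = ρ) ∧
    ∀ [ChartedSpace (PrincipalBundle.ModelJ1 E_M E_G) B.J1]
      [ChartedSpace (PrincipalBundle.ModelC E_M E_G) B.C]
      [ChartedSpace (PrincipalBundle.ModelJ1 E_M E_G) B.Pullback],
      B.IsStandardSmoothStructure →
      -- `p_G : J¹P → J¹P/G` is a principal `G`-bundle
      IsPrincipalBundle (G := G) 𝓘(ℝ, PrincipalBundle.ModelJ1 E_M E_G)
        𝓘(ℝ, PrincipalBundle.ModelC E_M E_G) 𝓘(ℝ, E_G) B.toC ∧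
      -- `p : J¹P/G → M` is smooth, and `p₁ : p^*P → J¹P/G` is a principal `G`-bundle
      ContMDiff 𝓘(ℝ, PrincipalBundle.ModelC E_M E_G) 𝓘(ℝ, E_M) ∞ B.projC ∧
      IsPrincipalBundle (G := G) 𝓘(ℝ, PrincipalBundle.ModelJ1 E_M E_G)
        𝓘(ℝ, PrincipalBundle.ModelC E_M E_G) 𝓘(ℝ, E_G) B.pullbackProj ∧
      -- `j¹_x s ↦ ([j¹_x s]_G, s(x))` is an isomorphism of principal `G`-bundles
      IsPrincipalBundleIso G 𝓘(ℝ, PrincipalBundle.ModelJ1 E_M E_G)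
        𝓘(ℝ, PrincipalBundle.ModelJ1 E_M E_G) B.toC B.pullbackProj B.toPullback ∧
      ∀ (s : M → P) (x : M) (hs : B.IsLocalSectionAt s x),
        B.pullbackIncl (B.toPullback (B.jet s x hs)) = (B.toC (B.jet s x hs), s x) := by
  refine ⟨⟨B.t2Space_J1, B.secondCountableTopology_J1, B.t2Space_C, B.secondCountableTopology_C⟩,
    ?_, B.exists_jet_eq, ?_⟩
  · obtain ⟨_, hJ, hi⟩ := B.exists_isSmoothEmbedding_incl
    obtain ⟨_, hC, hq⟩ := B.exists_isSubmersion_toC hi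
    obtain ⟨_, hP, hj⟩ := PrincipalBundle.exists_isSmoothEmbedding_pullbackIncl
      (PrincipalBundle.contMDiff_projC hi hq)
    exact ⟨_, _, _, hJ, hC, hP, hi, hq, hj⟩
  -- The atlases are now arbitrary, so only the embedding and submersion properties in `h` are
  -- available.
  · intro _ _ _ h
    have := h.isManifold_J1
    have hi := h.isSmoothEmbedding_incl
    have hq := h.isSubmersion_toC
    have hj := h.isSmoothEmbedding_pullbackIncl
    have hp := PrincipalBundle.contMDiff_projC hi hq
    exact ⟨PrincipalBundle.isPrincipalBundle_toC hi hq, hp,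
      PrincipalBundle.isPrincipalBundle_pullbackProj hp hj,
      PrincipalBundle.isPrincipalBundleIso_toPullback hi hq hj, fun _ _ _ => rfl⟩
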